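/- Let $d\ge 2$ be an integer and let $\mathcal G_1^d\subset\mathbb R^d$ be the cubic metric grid of edgelength $1$: its vertices are the points of $\mathbb Z^d$ and its edges are the unit segments joining the pairs of vertices at distance $1$ (each edge taken once, with the arclength measure). Let $H^1(\mathcal G_1^d)$ be the space of real functions $u$ on $\mathcal G_1^d$ that are absolutely continuous on every edge (hence continuous on $\mathcal G_1^d$) and such that $u,u'\in L^2(\mathcal G_1^d)$, where $u'$ is the derivative along the edges; norms on $\mathcal G_1^d$ are given by $\|u\|_{L^p(\mathcal G_1^d)}^p=\sum_{e}\int_e|u|^p\,dx$, the sum running over the edges. For $q>2$ and nonzero $u\in H^1(\mathcal G_1^d)$, nonzero real-valued $v\in H^1(\mathbb R^d)$, put $$Q_{q,\mathcal G_1^d}(u)=\frac{\|u\|_{L^q(\mathcal G_1^d)}^q}{\|u\|_{L^2(\mathcal G_1^d)}^{d+(2-d)\frac q2}\,\|u'\|_{L^2(\mathcal G_1^d)}^{(\frac q2-1)d}},\qquad Q_{q,\mathbb R^d}(v)=\frac{\|v\|_{L^q(\mathbb R^d)}^q}{\|v\|_{L^2(\mathbb R^d)}^{d+(2-d)\frac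 q2}\,\|\nabla v\|_{L^2(\mathbb R^d)}^{(\frac q2-1)d}},$$ $$K_{q,\mathcal G_1^d}=\sup_{0\ne u\in H^1(\mathcal G_1^d)}Q_{q,\mathcal G_1^d}(u),\qquad K_{q,\mathbb R^d}=\sup_{0\ne v\in H^1(\mathbb R^d)}Q_{q,\mathbb R^d}(v).$$ Let $q\in\left(2,2+\frac4d\right]$. If there exists a nonzero $u\in H^1(\mathcal G_1^d)$ such that $$Q_{q,\mathcal G_1^d}(u)\ \ge\ d^{\frac{(d-2)(q-2)}4}\,K_{q,\mathbb R^d},$$ then $K_{q,\mathcal G_1^d}$ is attained, that is, there exists a nonzero $w\in H^1(\mathcal G_1^d)$ with $Q_{q,\mathcal G_1^d}(w)=K_{q,\mathcal G_1^d}$. -/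

import Mathlib

open MeasureTheory Set
open scoped ENNReal ContDiff

noncomputable section

namespace CubicGrid

/-! ### The cubic grid with edges of length one -/

/-- The `d`-dimensional cubic grid `𝒢₁ᵈ` of edgelength `1`, as a subset of `ℝᵈ`: the union of the
unit segments joining the pairs of points of `ℤᵈ` at distance `1`, i.e. the set of points all of
whose coordinates, except possibly one, are integers. -/
def grid (d : ℕ) : Set (EuclideanSpace ℝ (Fin d)) :=
  {x | ∃ i : Fin d, ∀ j : Fin d, j ≠ i → ∃ n : ℤ, x j = n}

/-- The edges of the grid, each counted once: `(k, i)` is the edge from the vertex `k ∈ ℤᵈ` to the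
vertex `k + eᵢ`. -/
abbrev Edge (d : ℕ) : Type := (Fin d → ℤ) × Fin d

/-- The point `k + t eᵢ` of the grid. For `t ∈ [0, 1]` this is the arclength parametrization of the
edge `(k, i)`; for other `t` it is the continuation along the same line, which stays in the grid. -/
def edgePoint {d : ℕ} (e : Edge d) (t : ℝ) : grid d :=
  ⟨WithLp.toLp 2 fun j => (e.1 j : ℝ) + if j = e.2 then t else 0,
    e.2, fun j hj => ⟨e.1 j, by simp [hj]⟩⟩

/-- The natural measure on the disjoint union of the edges: Lebesgue measure on `[0, 1]` on every
edge. Vertices are null sets, so that `Lᵖ` of the grid is `Lᵖ` of this measure. -/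
def edgeMeasure (d : ℕ) : Measure (Edge d × ℝ) :=
  Measure.count.prod (volume.restrict (Icc (0 : ℝ) 1))

/-- A function on the grid, read in the coordinates of the edges. -/
def onEdges {d : ℕ} (u : grid d → ℝ) : Edge d × ℝ → ℝ :=
  fun p => u (edgePoint p.1 p.2)

/-- The derivative `u'` of a function on the grid, along the edges. -/
def edgeDeriv {d : ℕ} (u : grid d → ℝ) : Edge d × ℝ → ℝ :=
  fun p => deriv (fun t : ℝ => u (edgePoint p.1 t)) p.2

/-- `u ∈ H¹(𝒢₁ᵈ)`: on every edge `u` is absolutely continuous (hence `u` is continuous on the grid,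
as its value at a vertex is shared by all the edges that meet there), and `u` and `u'` belong
to `L²(𝒢₁ᵈ)`. -/
structure MemH1Grid {d : ℕ} (u : grid d → ℝ) : Prop where
  absolutelyContinuous : ∀ e : Edge d,
    AbsolutelyContinuousOnInterval (fun t : ℝ => u (edgePoint e t)) 0 1
  memLp : MemLp (onEdges u) 2 (edgeMeasure d)
  memLp_deriv : MemLp (edgeDeriv u) 2 (edgeMeasure d)

/-- The Gagliardo–Nirenberg quotient on the grid,
`‖u‖_q^q / (‖u‖_2^(d + (2 - d) q / 2) ‖u'‖_2^((q / 2 - 1) d))`, with values in `[0, ∞]`.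
It is meant for `u ≠ 0`. -/
def gridQuotient {d : ℕ} (q : ℝ) (u : grid d → ℝ) : ℝ≥0∞ :=
  eLpNorm (onEdges u) (ENNReal.ofReal q) (edgeMeasure d) ^ q /
    (eLpNorm (onEdges u) 2 (edgeMeasure d) ^ ((d : ℝ) + (2 - d) * (q / 2)) *
      eLpNorm (edgeDeriv u) 2 (edgeMeasure d) ^ ((q / 2 - 1) * (d : ℝ)))

/-- The sharp Gagliardo–Nirenberg constant `K_{q, 𝒢₁ᵈ}` of the grid. -/
def gridConstant (d : ℕ) (q : ℝ) : ℝ≥0∞ :=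
  ⨆ (u : grid d → ℝ) (_ : MemH1Grid u) (_ : u ≠ 0), gridQuotient q u

/-! ### The Euclidean space -/

/-- `v ∈ H¹(ℝᵈ)` with weak gradient `g`: both are square integrable, and
`∫ v ∂ᵢφ = - ∫ gᵢ φ` for all `i` and all smooth compactly supported `φ`. -/
structure IsH1WithGradient {d : ℕ} (v : EuclideanSpace ℝ (Fin d) → ℝ)
    (g : EuclideanSpace ℝ (Fin d) → EuclideanSpace ℝ (Fin d)) : Prop where
  memLp : MemLp v 2 volume
  memLp_gradient : MemLp g 2 volume
  integral_eq : ∀ φ : EuclideanSpace ℝ (Fin d) → ℝ, ContDiff ℝ ∞ φ → HasCompactSupport φ →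
    ∀ i : Fin d,
      ∫ x, v x * fderiv ℝ φ x (EuclideanSpace.single i 1) = - ∫ x, g x i * φ x

/-- The Gagliardo–Nirenberg quotient on `ℝᵈ` of a function `v` with weak gradient `g`, with values
in `[0, ∞]`. It is meant for `v` that does not vanish almost everywhere. -/
def euclideanQuotient {d : ℕ} (q : ℝ) (v : EuclideanSpace ℝ (Fin d) → ℝ)
    (g : EuclideanSpace ℝ (Fin d) → EuclideanSpace ℝ (Fin d)) : ℝ≥0∞ :=
  eLpNorm v (ENNReal.ofReal q) volume ^ q /
    (eLpNorm v 2 volume ^ ((d : ℝ) + (2 - d) * (q / 2)) *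
      eLpNorm g 2 volume ^ ((q / 2 - 1) * (d : ℝ)))

/-- The sharp Gagliardo–Nirenberg constant `K_{q, ℝᵈ}` of the Euclidean space. (The weak gradient is
unique up to null sets, so the supremum over `g` only names it.) -/
def euclideanConstant (d : ℕ) (q : ℝ) : ℝ≥0∞ :=
  ⨆ (v : EuclideanSpace ℝ (Fin d) → ℝ) (g : EuclideanSpace ℝ (Fin d) → EuclideanSpace ℝ (Fin d))
    (_ : IsH1WithGradient v g) (_ : ¬ v =ᵐ[volume] 0), euclideanQuotient q v g

end CubicGrid

end

/-! The quotient does not change when u is multiplied by a constant, so along a maximizing sequence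
only the ratio r = ‖u'‖₂/‖u‖₂ can degenerate. For large r the grid behaves like a one-dimensional
object: ‖u‖_∞² is at most a multiple of ‖u‖₂‖u'‖₂, so the quotient is at most a constant times
r^(-(q/2-1)(d-1)), which tends to 0 because d ≥ 2 (`exists_realQuotient_le_of_large_normDeriv`). For
small r the grid behaves like ℝᵈ, and the quotient is at most the threshold plus o(1)
(`exists_realQuotient_le_of_small_normDeriv`). Hence, once some quotient lies strictly above the
threshold, normalized maximizing sequences have ‖u'‖₂ in a compact subset of (0, ∞).

The comparison with ℝᵈ replaces u by its vertex values U, then by the step function of U on unit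
cubes, then by the average of that step function over translates in the unit cube. The average is in
H¹, its weak gradient consists of face averages of differences of U, and its gradient norm is at
most ‖u'‖₂ with no constant lost. Each replacement costs O(‖u'‖₂) in Lᵠ. This is negligible against
the main term, of order r^(b/q) with b = `expDeriv d q` ≤ 2 < q. Every vertex is the base of d
edges; this multiplicity produces the power of d in the threshold.

For compactness, the lower bound on the quotient keeps the maximum norm away from 0, so integer
translations produce a nonzero limit (`exists_maximizer`). The Brezis–Lieb lemma and weak
convergence split the norms between limit and remainder. Applying the Gagliardo–Nirenberg inequality
to both, strict superadditivity forces the limit to carry all the L² mass (`realQuotient_limit_eq`).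

If the threshold is merely reached, either the given function is already a maximizer or another
function lies strictly above the threshold. -/

noncomputable section

open Filter Topology
open scoped NNReal

namespace CubicGrid

variable {d : ℕ}

/-! ### Lebesgue measure on the unit interval and on the edges -/

/-- Lebesgue measure on the unit interval. -/
abbrev unitMeasure : Measure ℝ := volume.restrict (Icc (0 : ℝ) 1)

instance : IsProbabilityMeasure unitMeasure := ⟨by simp [unitMeasure]⟩

lemma edgeMeasure_eq_sum (d : ℕ) :
    edgeMeasure d = Measure.sum fun e : Edge d => unitMeasure.map (Prod.mk e) := by
  unfold edgeMeasure Measure.count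
  rw [Measure.prod_sum_left]
  simp_rw [Measure.dirac_prod]

lemma lintegral_edgeMeasure {d : ℕ} (F : Edge d × ℝ → ℝ≥0∞) :
    ∫⁻ p, F p ∂edgeMeasure d = ∑' e : Edge d, ∫⁻ t, F (e, t) ∂unitMeasure := by
  rw [edgeMeasure_eq_sum, lintegral_sum_measure]
  exact tsum_congr fun e => (measurableEmbedding_prodMk_left e).lintegral_map F

lemma ae_edgeMeasure_iff {d : ℕ} {p : Edge d × ℝ → Prop} :
    (∀ᵐ x ∂edgeMeasure d, p x) ↔ ∀ e : Edge d, ∀ᵐ t ∂unitMeasure, p (e, t) := by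
  rw [edgeMeasure_eq_sum, Measure.ae_sum_iff]
  exact forall_congr' fun e => (measurableEmbedding_prodMk_left e).ae_map_iff

lemma aestronglyMeasurable_edgeMeasure_iff {d : ℕ} {F : Edge d × ℝ → ℝ} :
    AEStronglyMeasurable F (edgeMeasure d) ↔
      ∀ e : Edge d, AEStronglyMeasurable (fun t => F (e, t)) unitMeasure := by
  rw [edgeMeasure_eq_sum, aestronglyMeasurable_sum_measure_iff]
  exact forall_congr' fun e =>
    (measurableEmbedding_prodMk_left e).aestronglyMeasurable_map_iff

lemma eLpNorm_two_sq {α : Type*} [MeasurableSpace α] (μ : Measure α) (f : α → ℝ) :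
    eLpNorm f 2 μ ^ 2 = ∫⁻ x, ‖f x‖ₑ ^ 2 ∂μ := by
  rw [eLpNorm_eq_lintegral_rpow_enorm_toReal (by simp) (by simp), ← ENNReal.rpow_two,
    ← ENNReal.rpow_mul]
  simp

lemma eLpNorm_ofReal_rpow {α : Type*} [MeasurableSpace α] (μ : Measure α) (f : α → ℝ) {q : ℝ}
    (hq : 0 < q) : eLpNorm f (ENNReal.ofReal q) μ ^ q = ∫⁻ x, ‖f x‖ₑ ^ q ∂μ := by
  rw [eLpNorm_eq_lintegral_rpow_enorm_toReal (by simp [hq]) (by simp), ENNReal.toReal_ofReal hq.le,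
    ← ENNReal.rpow_mul]
  simp [hq.ne']

lemma eLpNorm_edge_sq {d : ℕ} (F : Edge d × ℝ → ℝ) :
    eLpNorm F 2 (edgeMeasure d) ^ 2 =
      ∑' e : Edge d, eLpNorm (fun t => F (e, t)) 2 unitMeasure ^ 2 := by
  simp_rw [eLpNorm_two_sq, lintegral_edgeMeasure]

lemma eLpNorm_edge_le {d : ℕ} (F : Edge d × ℝ → ℝ) (e : Edge d) :
    eLpNorm (fun t => F (e, t)) 2 unitMeasure ≤ eLpNorm F 2 (edgeMeasure d) := by
  rw [← ENNReal.pow_le_pow_left_iff two_ne_zero, eLpNorm_edge_sq]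
  exact ENNReal.le_tsum (f := fun e => eLpNorm (fun t => F (e, t)) 2 unitMeasure ^ 2) e

/-! ### Absolutely continuous functions on the unit interval -/

lemma uIcc_subset_unit {s t : ℝ} (hs : s ∈ Icc (0 : ℝ) 1) (ht : t ∈ Icc (0 : ℝ) 1) :
    uIcc s t ⊆ uIcc (0 : ℝ) 1 := by
  rw [uIcc_of_le zero_le_one]; exact uIcc_subset_Icc hs ht

lemma uIoc_subset_unit {s t : ℝ} (hs : s ∈ Icc (0 : ℝ) 1) (ht : t ∈ Icc (0 : ℝ) 1) :
    uIoc s t ⊆ Icc (0 : ℝ) 1 :=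
  uIoc_subset_uIcc.trans (uIcc_subset_Icc hs ht)

lemma aestronglyMeasurable_of_intervalIntegrable {f : ℝ → ℝ}
    (hf : IntervalIntegrable f volume 0 1) : AEStronglyMeasurable f unitMeasure := by
  rw [intervalIntegrable_iff_integrableOn_Icc_of_le zero_le_one] at hf
  exact hf.aestronglyMeasurable

lemma aestronglyMeasurable_of_ac {f : ℝ → ℝ} (hf : AbsolutelyContinuousOnInterval f 0 1) :
    AEStronglyMeasurable f unitMeasure := by
  have := hf.continuousOn
  rw [uIcc_of_le zero_le_one] at this
  exact this.aestronglyMeasurable measurableSet_Icc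

lemma enorm_intervalIntegral_le_lintegral (f : ℝ → ℝ) (s t : ℝ) :
    ‖∫ x in s..t, f x‖ₑ ≤ ∫⁻ x in uIoc s t, ‖f x‖ₑ := by
  rw [← ofReal_norm, intervalIntegral.norm_intervalIntegral_eq, ofReal_norm]
  exact enorm_integral_le_lintegral_enorm _

lemma enorm_intervalIntegral_le {f : ℝ → ℝ} (hf : AEStronglyMeasurable f unitMeasure)
    {s t : ℝ} (hs : s ∈ Icc (0 : ℝ) 1) (ht : t ∈ Icc (0 : ℝ) 1) :
    ‖∫ x in s..t, f x‖ₑ ≤ ENNReal.ofReal |t - s| ^ (1 / 2 : ℝ) * eLpNorm f 2 unitMeasure := by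
  refine (enorm_intervalIntegral_le_lintegral f s t).trans ?_
  have hf' : AEStronglyMeasurable f (volume.restrict (uIoc s t)) :=
    hf.mono_measure (Measure.restrict_mono (uIoc_subset_unit hs ht) le_rfl)
  have h := eLpNorm_le_eLpNorm_mul_rpow_measure_univ (p := 1) (q := 2) one_le_two hf'
  rw [eLpNorm_one_eq_lintegral_enorm] at h
  refine h.trans ?_
  rw [mul_comm]
  gcongr
  · simp only [Measure.restrict_apply_univ, uIoc, Real.volume_Ioc, max_sub_min_eq_abs]
    norm_num
  · exact Measure.restrict_mono (uIoc_subset_unit hs ht) le_rfl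

lemma ac_sub_eq_integral {f : ℝ → ℝ} (hf : AbsolutelyContinuousOnInterval f 0 1)
    {s t : ℝ} (hs : s ∈ Icc (0 : ℝ) 1) (ht : t ∈ Icc (0 : ℝ) 1) :
    f t - f s = ∫ x in s..t, deriv f x :=
  ((hf.mono (uIcc_subset_unit hs ht)).integral_deriv_eq_sub).symm

lemma enorm_sub_le_of_ac {f : ℝ → ℝ} (hf : AbsolutelyContinuousOnInterval f 0 1)
    {s t : ℝ} (hs : s ∈ Icc (0 : ℝ) 1) (ht : t ∈ Icc (0 : ℝ) 1) :
    ‖f t - f s‖ₑ ≤ ENNReal.ofReal |t - s| ^ (1 / 2 : ℝ) * eLpNorm (deriv f) 2 unitMeasure := by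
  rw [ac_sub_eq_integral hf hs ht]
  exact enorm_intervalIntegral_le
    (aestronglyMeasurable_of_intervalIntegrable hf.intervalIntegrable_deriv) hs ht

lemma enorm_sub_le_of_ac' {f : ℝ → ℝ} (hf : AbsolutelyContinuousOnInterval f 0 1)
    {s t : ℝ} (hs : s ∈ Icc (0 : ℝ) 1) (ht : t ∈ Icc (0 : ℝ) 1) :
    ‖f t - f s‖ₑ ≤ eLpNorm (deriv f) 2 unitMeasure := by
  refine (enorm_sub_le_of_ac hf hs ht).trans (mul_le_of_le_one_left' ?_)
  refine ENNReal.rpow_le_one ?_ (by norm_num)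
  rw [ENNReal.ofReal_le_one, abs_le]
  constructor <;> linarith [hs.1, hs.2, ht.1, ht.2]

/-- The one-dimensional Gagliardo–Nirenberg bound of the maximum on the unit interval. -/
lemma enorm_sq_le_of_ac {f : ℝ → ℝ} (hf : AbsolutelyContinuousOnInterval f 0 1)
    {t : ℝ} (ht : t ∈ Icc (0 : ℝ) 1) :
    ‖f t‖ₑ ^ 2 ≤ eLpNorm f 2 unitMeasure ^ 2 +
      2 * (eLpNorm f 2 unitMeasure * eLpNorm (deriv f) 2 unitMeasure) := by
  set C := ∫⁻ x, ‖f x * deriv f x‖ₑ ∂unitMeasure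
  have hC : C ≤ eLpNorm f 2 unitMeasure * eLpNorm (deriv f) 2 unitMeasure := by
    have := eLpNorm_smul_le_mul_eLpNorm (p := 2) (q := 2) (r := 1)
      (aestronglyMeasurable_of_intervalIntegrable hf.intervalIntegrable_deriv)
      (aestronglyMeasurable_of_ac hf)
    rw [eLpNorm_one_eq_lintegral_enorm] at this
    exact this
  -- Integrate (f²)' = 2ff' from an arbitrary s to t; averaging over s afterwards turns |f s|² into
  -- the L² norm.
  have hpt : ∀ s ∈ Icc (0 : ℝ) 1, ‖f t‖ₑ ^ 2 ≤ ‖f s‖ₑ ^ 2 + 2 * C := by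
    intro s hs
    have hst := hf.mono (uIcc_subset_unit hs ht)
    have h1 := hst.integral_deriv_mul_eq_sub hst
    have h2 : f t ^ 2 = f s ^ 2 + ∫ x in s..t, 2 * (f x * deriv f x) := by
      have : ∫ x in s..t, 2 * (f x * deriv f x) =
          ∫ x in s..t, deriv f x * f x + f x * deriv f x := by
        congr 1; ext x; ring
      rw [this, h1]; ring
    calc ‖f t‖ₑ ^ 2 = ‖f t ^ 2‖ₑ := by rw [enorm_pow]
      _ ≤ ‖f s ^ 2‖ₑ + ‖∫ x in s..t, 2 * (f x * deriv f x)‖ₑ := by rw [h2]; exact enorm_add_le _ _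
      _ ≤ ‖f s‖ₑ ^ 2 + 2 * C := by
        rw [enorm_pow, intervalIntegral.integral_const_mul, enorm_mul]
        gcongr
        · simp [enorm_eq_nnnorm]
        · exact (enorm_intervalIntegral_le_lintegral _ s t).trans
            (lintegral_mono_set (uIoc_subset_unit hs ht))
  have : ∫⁻ _s, ‖f t‖ₑ ^ 2 ∂unitMeasure ≤ ∫⁻ s, (‖f s‖ₑ ^ 2 + 2 * C) ∂unitMeasure :=
    setLIntegral_mono' measurableSet_Icc hpt
  rw [lintegral_add_right _ measurable_const, lintegral_const, lintegral_const, measure_univ,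
    mul_one, mul_one, ← eLpNorm_two_sq] at this
  exact this.trans (by gcongr)

/-! ### The Brezis–Lieb lemma -/

/-- Convexity of x ↦ xᵖ with weights 1 - θ and θ gives the factors (1 - θ)^(1-p) and θ^(1-p); the
first tends to 1 as θ → 0. -/
lemma exists_abs_add_rpow_le {p : ℝ} (hp : 1 ≤ p) {ε : ℝ} (hε : 0 < ε) :
    ∃ C : ℝ, 0 ≤ C ∧ ∀ a b : ℝ, |a + b| ^ p ≤ (1 + ε) * |a| ^ p + C * |b| ^ p := by
  have hlim : Tendsto (fun θ : ℝ => (1 - θ) ^ (1 - p)) (𝓝[>] 0) (𝓝 1) := by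
    have : ContinuousAt (fun θ : ℝ => (1 - θ) ^ (1 - p)) 0 :=
      ContinuousAt.rpow_const (by fun_prop) (Or.inl (by norm_num))
    have h := this.tendsto
    simp only [sub_zero, Real.one_rpow] at h
    exact h.mono_left nhdsWithin_le_nhds
  have hev := (hlim.eventually (gt_mem_nhds (show (1 : ℝ) < 1 + ε by linarith))).and
    (Ioo_mem_nhdsGT (show (0 : ℝ) < 1 by norm_num))
  obtain ⟨θ, hθ, h0, h1⟩ := hev.exists
  refine ⟨θ ^ (1 - p), by positivity, fun a b => ?_⟩
  have hθ' : 0 < 1 - θ := by linarith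
  have hconv := (convexOn_rpow hp).2 (x := |a| / (1 - θ)) (y := |b| / θ)
    (by simp only [mem_Ici]; positivity) (by simp only [mem_Ici]; positivity)
    hθ'.le h0.le (by ring)
  simp only [smul_eq_mul] at hconv
  rw [mul_div_cancel₀ _ hθ'.ne', mul_div_cancel₀ _ h0.ne', Real.div_rpow (abs_nonneg _) hθ'.le,
    Real.div_rpow (abs_nonneg _) h0.le] at hconv
  have e1 : (1 - θ) * (|a| ^ p / (1 - θ) ^ p) = (1 - θ) ^ (1 - p) * |a| ^ p := by
    rw [Real.rpow_sub hθ', Real.rpow_one]; ring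
  have e2 : θ * (|b| ^ p / θ ^ p) = θ ^ (1 - p) * |b| ^ p := by
    rw [Real.rpow_sub h0, Real.rpow_one]; ring
  rw [e1, e2] at hconv
  calc |a + b| ^ p ≤ (|a| + |b|) ^ p :=
        Real.rpow_le_rpow (abs_nonneg _) (abs_add_le _ _) (by linarith)
    _ ≤ _ := hconv
    _ ≤ _ := by gcongr

/-- The defect V n is not dominated, but its excess over ε(|f n|ᵖ + |f n - g|ᵖ) is at most a
multiple of |g|ᵖ. Dominated convergence removes the excess, and what is left is ε times a bounded
quantity. -/
theorem tendsto_integral_rpow_sub {α : Type*} [MeasurableSpace α] {μ : Measure α} {p : ℝ}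
    (hp : 1 ≤ p) {f : ℕ → α → ℝ} {g : α → ℝ} (hf : ∀ n, AEStronglyMeasurable (f n) μ)
    (hg : AEStronglyMeasurable g μ) (hfi : ∀ n, Integrable (fun x => |f n x| ^ p) μ)
    (hgi : Integrable (fun x => |g x| ^ p) μ) {B : ℝ} (hB : ∀ n, ∫ x, |f n x| ^ p ∂μ ≤ B)
    (hlim : ∀ᵐ x ∂μ, Tendsto (fun n => f n x) atTop (𝓝 (g x))) :
    Tendsto (fun n => ∫ x, |f n x| ^ p ∂μ - ∫ x, |f n x - g x| ^ p ∂μ) atTop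
      (𝓝 (∫ x, |g x| ^ p ∂μ)) := by
  have hp0 : 0 < p := by linarith
  have hmeas : ∀ h : α → ℝ, AEStronglyMeasurable h μ →
      AEStronglyMeasurable (fun x => |h x| ^ p) μ := fun h hh =>
    (hh.aemeasurable.abs.pow_const p).aestronglyMeasurable
  obtain ⟨C₁, hC₁, hin₁⟩ := exists_abs_add_rpow_le hp one_pos
  have hdiff : ∀ n x, |f n x - g x| ^ p ≤ 2 * |f n x| ^ p + C₁ * |g x| ^ p := fun n x => by
    have := hin₁ (f n x) (-g x)
    rw [abs_neg] at this
    norm_num at this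
    rwa [sub_eq_add_neg]
  have hdi : ∀ n, Integrable (fun x => |f n x - g x| ^ p) μ := fun n => by
    refine (((hfi n).const_mul 2).add (hgi.const_mul C₁)).mono' (hmeas _ ((hf n).sub hg)) ?_
    refine Eventually.of_forall fun x => ?_
    rw [Real.norm_of_nonneg (by positivity)]
    exact hdiff n x
  set B' : ℝ := 2 * B + C₁ * ∫ x, |g x| ^ p ∂μ
  have hB' : ∀ n, ∫ x, |f n x - g x| ^ p ∂μ ≤ B' := fun n => by
    calc ∫ x, |f n x - g x| ^ p ∂μ ≤ ∫ x, (2 * |f n x| ^ p + C₁ * |g x| ^ p) ∂μ :=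
          integral_mono (hdi n) (((hfi n).const_mul 2).add (hgi.const_mul C₁)) (hdiff n)
      _ = 2 * (∫ x, |f n x| ^ p ∂μ) + C₁ * ∫ x, |g x| ^ p ∂μ := by
          rw [integral_add ((hfi n).const_mul 2) (hgi.const_mul C₁), integral_const_mul,
            integral_const_mul]
      _ ≤ B' := by simp only [B']; linarith [hB n]
  have hBB : 0 ≤ B + B' :=
    add_nonneg ((integral_nonneg fun x => by positivity).trans (hB 0))
      ((integral_nonneg fun x => by positivity).trans (hB' 0))
  rw [Metric.tendsto_atTop]
  intro η hη
  -- Chosen so that ε times the bound B + B' of ∫ S n stays below η/2.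
  set ε : ℝ := η / (2 * (B + B' + 1))
  have hε : 0 < ε := by positivity
  have hεB : ε * (B + B') < η / 2 := by
    have : ε * (B + B' + 1) = η / 2 := by simp only [ε]; field_simp
    nlinarith
  obtain ⟨C, hC, hin⟩ := exists_abs_add_rpow_le hp hε
  set V : ℕ → α → ℝ := fun n x => |f n x| ^ p - |f n x - g x| ^ p - |g x| ^ p
  set S : ℕ → α → ℝ := fun n x => |f n x| ^ p + |f n x - g x| ^ p
  have hVi : ∀ n, Integrable (V n) μ := fun n => ((hfi n).sub (hdi n)).sub hgi
  have hSi : ∀ n, Integrable (S n) μ := fun n => (hfi n).add (hdi n)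
  set W : ℕ → α → ℝ := fun n x => max 0 (|V n x| - ε * S n x)
  have hWm : ∀ n, AEStronglyMeasurable (W n) μ := fun n =>
    (aestronglyMeasurable_const.sup
      ((hVi n).abs.aestronglyMeasurable.sub ((hSi n).const_mul ε).aestronglyMeasurable))
  have hWb : ∀ n x, ‖W n x‖ ≤ (C + 1) * |g x| ^ p := fun n x => by
    rw [Real.norm_of_nonneg (le_max_left _ _)]
    have hgp : 0 ≤ |g x| ^ p := by positivity
    refine max_le (by positivity) ?_
    have i1 := hin (f n x - g x) (g x)
    have i2 := hin (f n x) (-g x)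
    rw [sub_add_cancel] at i1
    rw [abs_neg, ← sub_eq_add_neg] at i2
    have hfp : 0 ≤ |f n x| ^ p := by positivity
    have hdp : 0 ≤ |f n x - g x| ^ p := by positivity
    have : |V n x| ≤ ε * S n x + (C + 1) * |g x| ^ p := by
      rw [abs_le]; constructor <;> simp only [V, S] <;> nlinarith
    linarith
  have hWlim : ∀ᵐ x ∂μ, Tendsto (fun n => W n x) atTop (𝓝 0) := by
    filter_upwards [hlim] with x hx
    have c1 : Tendsto (fun n => |f n x| ^ p) atTop (𝓝 (|g x| ^ p)) :=
      (hx.abs).rpow_const (Or.inr hp0.le)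
    have c2 : Tendsto (fun n => |f n x - g x| ^ p) atTop (𝓝 0) := by
      have := ((hx.sub_const (g x)).abs).rpow_const (p := p) (Or.inr hp0.le)
      simpa [hp0.ne'] using this
    have c3 := (((c1.sub c2).sub_const (|g x| ^ p)).abs).sub ((c1.add c2).const_mul ε)
    have c4 := (tendsto_const_nhds (x := (0 : ℝ)) (f := atTop (α := ℕ))).max c3
    have e : max (0 : ℝ) (|(|g x| ^ p - 0 - |g x| ^ p)| - ε * (|g x| ^ p + 0)) = 0 := by
      have : 0 ≤ |g x| ^ p := by positivity
      simp only [sub_zero, sub_self, abs_zero, add_zero, zero_sub]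
      exact max_eq_left (by nlinarith)
    rw [e] at c4
    exact c4
  have hWt : Tendsto (fun n => ∫ x, W n x ∂μ) atTop (𝓝 0) := by
    have := tendsto_integral_of_dominated_convergence (F := W) (f := fun _ => (0 : ℝ)) _ hWm
      (hgi.const_mul (C + 1)) (fun n => Eventually.of_forall (hWb n)) hWlim
    simpa using this
  obtain ⟨N, hN⟩ := (Metric.tendsto_atTop.1 hWt) (η / 2) (by positivity)
  refine ⟨N, fun n hn => ?_⟩
  have hWn := hN n hn
  rw [Real.dist_eq, sub_zero] at hWn
  have hWi : Integrable (W n) μ :=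
    (hgi.const_mul (C + 1)).mono' (hWm n) (Eventually.of_forall (hWb n))
  have hVeq : ∫ x, |f n x| ^ p ∂μ - ∫ x, |f n x - g x| ^ p ∂μ - ∫ x, |g x| ^ p ∂μ
      = ∫ x, V n x ∂μ := by
    have h := integral_sub ((hfi n).sub (hdi n)) hgi
    simp only [Pi.sub_apply] at h
    rw [← integral_sub (hfi n) (hdi n), ← h]
  rw [Real.dist_eq, hVeq]
  calc |∫ x, V n x ∂μ| ≤ ∫ x, |V n x| ∂μ := abs_integral_le_integral_abs
    _ ≤ ∫ x, (W n x + ε * S n x) ∂μ := by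
        refine integral_mono (hVi n).abs (hWi.add ((hSi n).const_mul ε)) fun x => ?_
        have : |V n x| - ε * S n x ≤ W n x := le_max_right _ _
        simp only; linarith
    _ = ∫ x, W n x ∂μ + ε * (∫ x, |f n x| ^ p ∂μ + ∫ x, |f n x - g x| ^ p ∂μ) := by
        rw [integral_add hWi ((hSi n).const_mul ε), integral_const_mul,
          integral_add (hfi n) (hdi n)]
    _ ≤ |∫ x, W n x ∂μ| + ε * (B + B') := by
        gcongr
        · exact le_abs_self _
        · exact hB n
        · exact hB' n
    _ < η := by linarith

/-! ### Averages -/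

/-- On a probability space the p-th power of an average is at most the average of the p-th powers;
Tonelli then exchanges the integrals. -/
lemma eLpNorm_integral_le {α β : Type*} [MeasurableSpace α] [MeasurableSpace β] {μ : Measure α}
    [SFinite μ] {ν : Measure β} [IsProbabilityMeasure ν] {F : α → β → ℝ}
    (hF : Measurable (Function.uncurry F)) {p : ℝ} (hp : 1 ≤ p) {C : ℝ≥0∞}
    (hC : ∀ᵐ y ∂ν, eLpNorm (fun x => F x y) (ENNReal.ofReal p) μ ≤ C) :
    eLpNorm (fun x => ∫ y, F x y ∂ν) (ENNReal.ofReal p) μ ≤ C := by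
  have hp0 : 0 < p := by linarith
  rw [← ENNReal.rpow_le_rpow_iff hp0, eLpNorm_ofReal_rpow _ _ hp0]
  have hx : ∀ x, ‖∫ y, F x y ∂ν‖ₑ ^ p ≤ ∫⁻ y, ‖F x y‖ₑ ^ p ∂ν := fun x => by
    have hFx : AEStronglyMeasurable (F x) ν :=
      (hF.comp measurable_prodMk_left).aestronglyMeasurable
    rw [← eLpNorm_ofReal_rpow _ _ hp0]
    refine ENNReal.rpow_le_rpow ?_ hp0.le
    refine (enorm_integral_le_lintegral_enorm _).trans ?_
    rw [← eLpNorm_one_eq_lintegral_enorm]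
    exact eLpNorm_le_eLpNorm_of_exponent_le (by simpa using hp) hFx
  calc ∫⁻ x, ‖∫ y, F x y ∂ν‖ₑ ^ p ∂μ ≤ ∫⁻ x, ∫⁻ y, ‖F x y‖ₑ ^ p ∂ν ∂μ := lintegral_mono hx
    _ = ∫⁻ y, ∫⁻ x, ‖F x y‖ₑ ^ p ∂μ ∂ν :=
        lintegral_lintegral_swap (hF.enorm.pow_const p).aemeasurable
    _ ≤ ∫⁻ _y, C ^ p ∂ν := by
        refine lintegral_mono_ae (hC.mono fun y hy => ?_)
        rw [← eLpNorm_ofReal_rpow _ _ hp0]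
        exact ENNReal.rpow_le_rpow hy hp0.le
    _ = C ^ p := by simp

/-! ### Step functions -/

/-- The vector of the integer parts of the coordinates. -/
def intPart (x : EuclideanSpace ℝ (Fin d)) : Fin d → ℤ := fun i => ⌊x i⌋

/-- The step function that takes the value `U k` on the unit cube with lower corner `k`. -/
def step (U : (Fin d → ℤ) → ℝ) (x : EuclideanSpace ℝ (Fin d)) : ℝ := U (intPart x)

/-- The forward difference in direction `i`. -/
def diff (i : Fin d) (U : (Fin d → ℤ) → ℝ) (k : Fin d → ℤ) : ℝ := U (k + Pi.single i 1) - U k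

lemma measurable_intPart : Measurable (intPart (d := d)) :=
  measurable_pi_iff.2 fun i => Int.measurable_floor.comp
    ((measurable_pi_apply i).comp (MeasurableEquiv.toLp 2 (Fin d → ℝ)).symm.measurable)

lemma measurable_step (U : (Fin d → ℤ) → ℝ) : Measurable (step U) :=
  (measurable_of_countable U).comp measurable_intPart

/-- Each fibre is a half-open unit cube, of volume one. Hence `step` is an isometry from the
sequence spaces to the Lebesgue spaces. -/
lemma measurePreserving_intPart :
    MeasurePreserving (intPart (d := d)) volume Measure.count := by
  refine ⟨measurable_intPart, Measure.ext_iff_singleton.2 fun k => ?_⟩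
  rw [Measure.map_apply measurable_intPart (measurableSet_singleton k), Measure.count_singleton]
  have h : intPart ⁻¹' {k} = (WithLp.ofLp : EuclideanSpace ℝ (Fin d) → Fin d → ℝ) ⁻¹'
      (univ.pi fun i => Ico (k i : ℝ) (k i + 1)) := by
    ext x
    simp only [mem_preimage, mem_singleton_iff, intPart, funext_iff, Int.floor_eq_iff, Set.mem_pi,
      mem_univ, true_imp_iff, mem_Ico]
  rw [h, (PiLp.volume_preserving_ofLp (Fin d)).measure_preimage
    (MeasurableSet.univ_pi fun i => measurableSet_Ico).nullMeasurableSet, Real.volume_pi_Ico]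
  simp

lemma eLpNorm_step (U : (Fin d → ℤ) → ℝ) (p : ℝ≥0∞) :
    eLpNorm (step U) p volume = eLpNorm U p Measure.count :=
  eLpNorm_comp_measurePreserving (measurable_of_countable U).aestronglyMeasurable
    measurePreserving_intPart

lemma eLpNorm_step_add (U : (Fin d → ℤ) → ℝ) (p : ℝ≥0∞) (y : EuclideanSpace ℝ (Fin d)) :
    eLpNorm (fun x => step U (x + y)) p volume = eLpNorm U p Measure.count := by
  rw [← eLpNorm_step]
  exact eLpNorm_comp_measurePreserving (measurable_step U).aestronglyMeasurable
    (measurePreserving_add_right volume y)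

lemma intPart_add_single (x : EuclideanSpace ℝ (Fin d)) (i : Fin d) (t : ℝ) (m : ℤ)
    (h : ⌊x i + t⌋ = ⌊x i⌋ + m) :
    intPart (x + EuclideanSpace.single i t) = intPart x + Pi.single i m := by
  funext j
  by_cases hj : j = i
  · subst hj; simp [intPart, h]
  · simp [intPart, hj]

lemma step_diff (U : (Fin d → ℤ) → ℝ) (i : Fin d) (x : EuclideanSpace ℝ (Fin d)) :
    step (diff i U) x = step U (x + EuclideanSpace.single i 1) - step U x := by
  simp only [step, diff]
  rw [intPart_add_single x i 1 1 (by simp)]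

/-- A move of length at most one along a coordinate axis crosses at most one integer, so the step
function changes by nothing or by exactly one forward difference. -/
lemma abs_step_add_single_sub_le (U : (Fin d → ℤ) → ℝ) (i : Fin d) {t : ℝ}
    (ht : t ∈ Icc (0 : ℝ) 1) (x : EuclideanSpace ℝ (Fin d)) :
    ‖step U (x + EuclideanSpace.single i t) - step U x‖ ≤ ‖step (diff i U) x‖ := by
  have h1 : ⌊x i⌋ ≤ ⌊x i + t⌋ := Int.floor_mono (by linarith [ht.1])
  have h2 : ⌊x i + t⌋ ≤ ⌊x i⌋ + 1 := by
    rw [← Int.floor_add_one]; exact Int.floor_mono (by linarith [ht.2])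
  have h3 : ⌊x i + t⌋ = ⌊x i⌋ + 0 ∨ ⌊x i + t⌋ = ⌊x i⌋ + 1 := by omega
  rcases h3 with h | h
  · rw [step, intPart_add_single x i t 0 h]
    simp [step]
  · simp only [step, diff]
    rw [intPart_add_single x i t 1 h]

/-- Translate by y one coordinate at a time. By translation invariance the move along coordinate i
costs at most the norm of `diff i U`. -/
lemma eLpNorm_step_add_sub_le (U : (Fin d → ℤ) → ℝ) {p : ℝ≥0∞} (hp : 1 ≤ p)
    {y : Fin d → ℝ} (hy : ∀ i, y i ∈ Icc (0 : ℝ) 1) :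
    eLpNorm (fun x => step U (x + WithLp.toLp 2 y) - step U x) p volume ≤
      ∑ i, eLpNorm (diff i U) p Measure.count := by
  have key : ∀ s : Finset (Fin d),
      eLpNorm (fun x => step U (x + ∑ i ∈ s, EuclideanSpace.single i (y i)) - step U x) p volume ≤
        ∑ i ∈ s, eLpNorm (diff i U) p Measure.count := by
    intro s
    induction s using Finset.induction_on with
    | empty => simp
    | insert i s hi ih =>
      set z := ∑ i ∈ s, EuclideanSpace.single i (y i) with hz
      have hm : ∀ c, AEStronglyMeasurable (fun x : EuclideanSpace ℝ (Fin d) => step U (x + c))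
          volume := fun c => ((measurable_step U).comp (measurable_add_const c)).aestronglyMeasurable
      have hm0 := (measurable_step U).aestronglyMeasurable (μ := (volume : Measure
        (EuclideanSpace ℝ (Fin d))))
      rw [Finset.sum_insert hi, Finset.sum_insert hi, ← hz]
      have hsplit : (fun x => step U (x + (EuclideanSpace.single i (y i) + z)) - step U x) =
          (fun x => step U (x + (EuclideanSpace.single i (y i) + z)) - step U (x + z)) +
          (fun x => step U (x + z) - step U x) := by
        funext x; simp
      rw [hsplit]
      refine (eLpNorm_add_le ((hm _).sub (hm _)) ((hm _).sub hm0) hp).trans (add_le_add ?_ ih)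
      rw [← eLpNorm_step_add (diff i U) p z]
      refine eLpNorm_mono fun x => ?_
      have := abs_step_add_single_sub_le U i (hy i) (x + z)
      rwa [add_assoc, add_comm z] at this
  have hsum : WithLp.toLp 2 y = ∑ i, EuclideanSpace.single i (y i) := by
    ext j
    simp [Finset.sum_apply, Pi.single_apply]
  rw [hsum]
  exact key Finset.univ

/-! ### Averages over the unit cube -/

/-- The uniform probability measure on the unit cube. -/
abbrev cubeMeasure (d : ℕ) : Measure (Fin d → ℝ) := Measure.pi fun _ => unitMeasure

/-- Resampling one coordinate independently leaves a product of probability measures unchanged. This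
allows integration in a single coordinate without splitting the index set. -/
lemma measurePreserving_update (i : Fin d) :
    MeasurePreserving (fun p : (Fin d → ℝ) × ℝ => Function.update p.1 i p.2)
      ((cubeMeasure d).prod unitMeasure) (cubeMeasure d) := by
  refine ⟨measurable_update', (Measure.pi_eq fun s hs => ?_).symm⟩
  rw [Measure.map_apply measurable_update' (MeasurableSet.univ_pi hs)]
  have h : (fun p : (Fin d → ℝ) × ℝ => Function.update p.1 i p.2) ⁻¹' univ.pi s =
      (univ.pi (Function.update s i univ)) ×ˢ s i := by
    ext p
    simp only [mem_preimage, Set.mem_pi, mem_univ, true_imp_iff, mem_prod]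
    constructor
    · intro hp
      refine ⟨fun j => ?_, by simpa using hp i⟩
      by_cases hj : j = i
      · subst hj; simp
      · simpa [hj] using hp j
    · rintro ⟨h1, h2⟩ j
      by_cases hj : j = i
      · subst hj; simpa using h2
      · simpa [hj] using h1 j
  rw [h, Measure.prod_prod, Measure.pi_pi, ← Finset.mul_prod_erase _ _ (Finset.mem_univ i),
    ← Finset.mul_prod_erase _ _ (Finset.mem_univ i)]
  simp only [Function.update_self, measure_univ, one_mul]
  rw [mul_comm]
  congr 1
  refine Finset.prod_congr rfl fun j hj => ?_
  rw [Function.update_of_ne (Finset.ne_of_mem_erase hj)]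

lemma ae_mem_cube : ∀ᵐ y ∂cubeMeasure d, ∀ i, y i ∈ Icc (0 : ℝ) 1 := by
  rw [ae_all_iff]
  intro i
  exact (measurePreserving_eval (fun _ => unitMeasure) i).quasiMeasurePreserving.ae
    (ae_restrict_mem measurableSet_Icc)

/-! ### Transfer of an average from a bounded function to a test function -/

section Pairing

variable {T : Type*} [MeasurableSpace T] {ν : Measure T} [IsProbabilityMeasure ν]
  {s ψ : EuclideanSpace ℝ (Fin d) → ℝ} {c : T → EuclideanSpace ℝ (Fin d)}

lemma integrable_comp_sub (hψ : Continuous ψ) (hψi : Integrable ψ volume) (hc : Measurable c) :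
    Integrable (fun p : EuclideanSpace ℝ (Fin d) × T => ψ (p.1 - c p.2)) (volume.prod ν) := by
  have hm : Measurable fun p : EuclideanSpace ℝ (Fin d) × T => ψ (p.1 - c p.2) :=
    hψ.measurable.comp (measurable_fst.sub (hc.comp measurable_snd))
  rw [integrable_prod_iff' hm.aestronglyMeasurable]
  refine ⟨Eventually.of_forall fun t => hψi.comp_sub_right (c t), ?_⟩
  have : ∀ t, ∫ x, ‖ψ (x - c t)‖ = ∫ x, ‖ψ x‖ := fun t =>
    integral_sub_right_eq_self (fun x => ‖ψ x‖) (c t)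
  simp only [this]
  exact integrable_const _

/-- Fubini and the substitution z = x + c t. -/
lemma integral_average_mul (hs : Measurable s) {B : ℝ} (hB : ∀ x, ‖s x‖ ≤ B) (hψ : Continuous ψ)
    (hψi : Integrable ψ volume) (hc : Measurable c) :
    ∫ x : EuclideanSpace ℝ (Fin d), (∫ t : T, s (x + c t) ∂ν) * ψ x =
      ∫ z : EuclideanSpace ℝ (Fin d), s z * (∫ t : T, ψ (z - c t) ∂ν) := by
  have hi1 : Integrable (Function.uncurry fun x t => s (x + c t) * ψ x) (volume.prod ν) := by
    refine Integrable.bdd_mul (c := B) (hψi.comp_fst ν) ?_ (Eventually.of_forall fun p => hB _)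
    exact (hs.comp (measurable_fst.add (hc.comp measurable_snd))).aestronglyMeasurable
  have hi2 : Integrable (Function.uncurry fun z t => s z * ψ (z - c t)) (volume.prod ν) :=
    Integrable.bdd_mul (c := B) (integrable_comp_sub hψ hψi hc)
      (hs.comp measurable_fst).aestronglyMeasurable (Eventually.of_forall fun p => hB _)
  calc ∫ x : EuclideanSpace ℝ (Fin d), (∫ t, s (x + c t) ∂ν) * ψ x
      = ∫ x, (∫ t, s (x + c t) * ψ x ∂ν) := by
        simp_rw [integral_mul_const]
    _ = ∫ t, (∫ x, s (x + c t) * ψ x) ∂ν := integral_integral_swap hi1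
    _ = ∫ t, (∫ z, s z * ψ (z - c t)) ∂ν := by
        congr 1; funext t
        rw [← integral_add_right_eq_self (fun z => s z * ψ (z - c t)) (c t)]
        simp
    _ = ∫ z, (∫ t, s z * ψ (z - c t) ∂ν) := (integral_integral_swap hi2).symm
    _ = _ := by simp_rw [integral_const_mul]

end Pairing

/-- The average of the step function of `U` over the unit cube with lower corner `x`. This is the
interpolation of `U` by tensor products of hat functions, up to a reflection. -/
def average (U : (Fin d → ℤ) → ℝ) (x : EuclideanSpace ℝ (Fin d)) : ℝ :=
  ∫ y, step U (x + WithLp.toLp 2 y) ∂cubeMeasure d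

/-- The weak gradient of `average U`. -/
def averageGradient (U : (Fin d → ℤ) → ℝ) (x : EuclideanSpace ℝ (Fin d)) :
    EuclideanSpace ℝ (Fin d) :=
  WithLp.toLp 2 fun i =>
    ∫ y, step (diff i U) (x + WithLp.toLp 2 (Function.update y i 0)) ∂cubeMeasure d

lemma measurable_toLp : Measurable (WithLp.toLp 2 : (Fin d → ℝ) → EuclideanSpace ℝ (Fin d)) :=
  (MeasurableEquiv.toLp 2 (Fin d → ℝ)).measurable

lemma measurable_face (i : Fin d) :
    Measurable fun y : Fin d → ℝ =>
      (WithLp.toLp 2 (Function.update y i 0) : EuclideanSpace ℝ (Fin d)) :=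
  measurable_toLp.comp (measurable_update'.comp (measurable_id.prodMk measurable_const))

lemma measurable_step_add (U : (Fin d → ℤ) → ℝ)
    {c : (Fin d → ℝ) → EuclideanSpace ℝ (Fin d)} (hc : Measurable c) :
    Measurable (Function.uncurry fun x y => step U (x + c y)) :=
  (measurable_step U).comp (measurable_fst.add (hc.comp measurable_snd))

lemma stronglyMeasurable_average (U : (Fin d → ℤ) → ℝ)
    {c : (Fin d → ℝ) → EuclideanSpace ℝ (Fin d)} (hc : Measurable c) :
    StronglyMeasurable fun x => ∫ y, step U (x + c y) ∂cubeMeasure d :=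
  (measurable_step_add U hc).stronglyMeasurable.integral_prod_right

lemma eLpNorm_average_le (U : (Fin d → ℤ) → ℝ) {p : ℝ} (hp : 1 ≤ p)
    {c : (Fin d → ℝ) → EuclideanSpace ℝ (Fin d)} (hc : Measurable c) :
    eLpNorm (fun x => ∫ y, step U (x + c y) ∂cubeMeasure d) (ENNReal.ofReal p) volume ≤
      eLpNorm U (ENNReal.ofReal p) Measure.count :=
  eLpNorm_integral_le (measurable_step_add U hc) hp
    (Eventually.of_forall fun y => (eLpNorm_step_add U _ (c y)).le)

lemma exists_bound_of_memLp {ι : Type*} [MeasurableSpace ι] [MeasurableSingletonClass ι]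
    {U : ι → ℝ} (hU : MemLp U 2 Measure.count) : ∃ B : ℝ, ∀ k, ‖U k‖ ≤ B := by
  refine ⟨(eLpNorm U 2 Measure.count).toReal, fun k => ?_⟩
  have h : ‖U k‖ₑ ≤ eLpNorm U 2 Measure.count := by
    rw [← ENNReal.pow_le_pow_left_iff two_ne_zero, eLpNorm_two_sq, lintegral_count]
    exact ENNReal.le_tsum (f := fun k => ‖U k‖ₑ ^ 2) k
  have := ENNReal.toReal_mono hU.2.ne h
  rwa [toReal_enorm] at this

lemma memLp_diff {U : (Fin d → ℤ) → ℝ} (hU : MemLp U 2 Measure.count) (i : Fin d) :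
    MemLp (diff i U) 2 Measure.count :=
  (hU.comp_measurePreserving
    (measurePreserving_add_right (Measure.count : Measure (Fin d → ℤ)) (Pi.single i 1))).sub hU

/-- `average U` is a mean of translates of `step U` by points y of the unit cube, and each translate
is within the sum of the difference norms of `step U`. -/
lemma eLpNorm_sub_average_le {U : (Fin d → ℤ) → ℝ} (hU : MemLp U 2 Measure.count) {p : ℝ}
    (hp : 1 ≤ p) :
    eLpNorm (step U - average U) (ENNReal.ofReal p) volume ≤
      ∑ i, eLpNorm (diff i U) (ENNReal.ofReal p) Measure.count := by
  obtain ⟨B, hB⟩ := exists_bound_of_memLp hU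
  have hm := measurable_step_add U (measurable_toLp (d := d))
  have h : average U - step U = fun x =>
      ∫ y, (step U (x + WithLp.toLp 2 y) - step U x) ∂cubeMeasure d := by
    funext x
    rw [integral_sub _ (integrable_const _)]
    · simp [average]
    · exact Integrable.of_bound (hm.comp measurable_prodMk_left).aestronglyMeasurable B
        (Eventually.of_forall fun y => hB _)
  rw [eLpNorm_sub_comm, h]
  refine eLpNorm_integral_le (hm.sub ((measurable_step U).comp measurable_fst)) hp ?_
  filter_upwards [ae_mem_cube] with y hy
  exact eLpNorm_step_add_sub_le U (by simpa using hp) hy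

/-- Each component of the gradient is an average of translates of the step function of `diff i U`,
and averaging does not increase the norm. The constant one is essential, since the threshold is
sharp in the gradient norm. -/
lemma eLpNorm_averageGradient_sq_le (U : (Fin d → ℤ) → ℝ) :
    eLpNorm (averageGradient U) 2 volume ^ 2 ≤ ∑ i, eLpNorm (diff i U) 2 Measure.count ^ 2 := by
  have h1 : ∀ x, ‖averageGradient U x‖ₑ ^ 2 = ∑ i, ‖averageGradient U x i‖ₑ ^ 2 := fun x => by
    simp only [← ofReal_norm, ← ENNReal.ofReal_pow (norm_nonneg _)]
    rw [← ENNReal.ofReal_sum_of_nonneg fun i _ => by positivity, EuclideanSpace.norm_sq_eq]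
  have h2 : eLpNorm (averageGradient U) 2 volume ^ 2 =
      ∫⁻ x, ‖averageGradient U x‖ₑ ^ 2 := by
    rw [eLpNorm_eq_lintegral_rpow_enorm_toReal (by simp) (by simp), ← ENNReal.rpow_two,
      ← ENNReal.rpow_mul]
    simp
  rw [h2]
  simp_rw [h1]
  rw [lintegral_finsetSum']
  · refine Finset.sum_le_sum fun i _ => ?_
    rw [← eLpNorm_two_sq]
    gcongr
    have := eLpNorm_average_le (diff i U) (p := 2) one_le_two (measurable_face i)
    rw [ENNReal.ofReal_ofNat] at this
    exact this
  · intro i _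
    exact ((stronglyMeasurable_average (diff i U) (measurable_face i)).measurable.enorm.pow_const
      2).aemeasurable

lemma measurable_averageGradient (U : (Fin d → ℤ) → ℝ) : Measurable (averageGradient U) :=
  measurable_toLp.comp (measurable_pi_iff.2 fun i =>
    (stronglyMeasurable_average (diff i U) (measurable_face i)).measurable)

lemma toLp_update (y : Fin d → ℝ) (i : Fin d) (t : ℝ) :
    (WithLp.toLp 2 (Function.update y i t) : EuclideanSpace ℝ (Fin d)) =
      WithLp.toLp 2 (Function.update y i 0) + EuclideanSpace.single i t := by
  ext j
  by_cases hj : j = i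
  · subst hj; simp
  · simp [hj]

/-- Averaging a partial derivative over the cube gives a difference of averages over a face. -/
lemma integral_fderiv_cube {φ : EuclideanSpace ℝ (Fin d) → ℝ} (hφ : ContDiff ℝ ∞ φ)
    (hφc : HasCompactSupport φ) (i : Fin d) (z : EuclideanSpace ℝ (Fin d)) :
    ∫ y, fderiv ℝ φ (z - WithLp.toLp 2 y) (EuclideanSpace.single i 1) ∂cubeMeasure d =
      ∫ y, φ (z - WithLp.toLp 2 (Function.update y i 0)) ∂cubeMeasure d -
      ∫ y, φ (z - EuclideanSpace.single i 1 - WithLp.toLp 2 (Function.update y i 0))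
        ∂cubeMeasure d := by
  set ψ : EuclideanSpace ℝ (Fin d) → ℝ := fun x => fderiv ℝ φ x (EuclideanSpace.single i 1)
  have hψ : Continuous ψ := (hφ.continuous_fderiv (by simp)).clm_apply continuous_const
  have hψc : HasCompactSupport ψ := hφc.fderiv_apply ℝ _
  obtain ⟨B, hB⟩ := hψ.bounded_above_of_compact_support hψc
  obtain ⟨B', hB'⟩ := hφ.continuous.bounded_above_of_compact_support hφc
  have hmeas : Measurable fun y : Fin d → ℝ => ψ (z - WithLp.toLp 2 y) :=
    hψ.measurable.comp (measurable_const.sub measurable_toLp)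
  have hint : Integrable (fun p : (Fin d → ℝ) × ℝ =>
      ψ (z - WithLp.toLp 2 (Function.update p.1 i p.2)))
      ((cubeMeasure d).prod unitMeasure) :=
    Integrable.of_bound (hmeas.comp measurable_update').aestronglyMeasurable B
      (Eventually.of_forall fun p => hB _)
  have hφi : ∀ w, Integrable (fun y : Fin d → ℝ =>
      φ (w - WithLp.toLp 2 (Function.update y i 0))) (cubeMeasure d) := fun w =>
    Integrable.of_bound (hφ.continuous.measurable.comp
      (measurable_const.sub (measurable_face i))).aestronglyMeasurable B'
      (Eventually.of_forall fun p => hB' _)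
  -- The coordinate y i is replaced by an independent uniform variable t, in which the fundamental
  -- theorem of calculus then applies.
  have h1 : ∫ y, ψ (z - WithLp.toLp 2 y) ∂cubeMeasure d =
      ∫ y, (∫ t, ψ (z - WithLp.toLp 2 (Function.update y i t)) ∂unitMeasure) ∂cubeMeasure d := by
    have := integral_map (μ := (cubeMeasure d).prod unitMeasure)
      (φ := fun p : (Fin d → ℝ) × ℝ => Function.update p.1 i p.2) measurable_update'.aemeasurable
      hmeas.aestronglyMeasurable
    rw [(measurePreserving_update i).map_eq] at this
    rw [this, integral_prod _ hint]
  have hftc : ∀ w, ∫ t, ψ (w - EuclideanSpace.single i t) ∂unitMeasure =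
      φ w - φ (w - EuclideanSpace.single i 1) := by
    intro w
    obtain ⟨v, hv⟩ : ∃ v : EuclideanSpace ℝ (Fin d), v = EuclideanSpace.single i 1 := ⟨_, rfl⟩
    have hs : ∀ t : ℝ, (EuclideanSpace.single i t : EuclideanSpace ℝ (Fin d)) = t • v :=
      fun t => by
        rw [hv]; ext j; by_cases hj : j = i <;> simp [hj]
    simp_rw [hs]
    have hd : ∀ t ∈ uIcc (0 : ℝ) 1, HasDerivAt (fun t : ℝ => -φ (w - t • v)) (ψ (w - t • v)) t := by
      intro t _
      have hl : HasDerivAt (fun t : ℝ => w - t • v) (-v) t := by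
        simpa using ((hasDerivAt_id t).smul_const v).const_sub w
      have hf := (hφ.differentiable (by simp) (w - t • v)).hasFDerivAt
      have := (hf.comp_hasDerivAt t hl).neg
      rw [map_neg, neg_neg, hv] at this
      rw [hv]
      exact this
    have hc : Continuous fun t : ℝ => ψ (w - t • v) := hψ.comp (by fun_prop)
    have := intervalIntegral.integral_eq_sub_of_hasDerivAt hd (hc.intervalIntegrable _ _)
    rw [intervalIntegral.integral_of_le zero_le_one, ← integral_Icc_eq_integral_Ioc] at this
    rw [this]
    simp only [zero_smul, sub_zero]; ring
  rw [h1, ← integral_sub (hφi _) (hφi _)]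
  congr 1
  funext y
  have e : ∀ t, z - WithLp.toLp 2 (Function.update y i t) =
      z - WithLp.toLp 2 (Function.update y i 0) - EuclideanSpace.single i t := fun t => by
    rw [toLp_update y i t, sub_sub]
  rw [sub_right_comm z, ← hftc]
  congr 1
  funext t
  rw [e t]

/-- Summation by parts: the average moves onto ∂ᵢφ, where it becomes the difference Φ(z) - Φ(z - eᵢ)
of face averages Φ of φ. A translation by eᵢ puts this difference back on U. -/
theorem isH1WithGradient_average {U : (Fin d → ℤ) → ℝ} (hU : MemLp U 2 Measure.count) :
    IsH1WithGradient (average U) (averageGradient U) := by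
  obtain ⟨B, hB⟩ := exists_bound_of_memLp hU
  refine ⟨⟨(stronglyMeasurable_average U measurable_toLp).aestronglyMeasurable, ?_⟩,
    ⟨(measurable_averageGradient U).aestronglyMeasurable, ?_⟩, fun φ hφ hφc i => ?_⟩
  · have := eLpNorm_average_le U (p := 2) one_le_two measurable_toLp
    simp only [ENNReal.ofReal_ofNat] at this
    exact this.trans_lt hU.2
  · have h : ∑ i, eLpNorm (diff i U) 2 Measure.count ^ 2 < ⊤ :=
      ENNReal.sum_lt_top.2 fun i _ => ENNReal.pow_lt_top (memLp_diff hU i).2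
    by_contra hcon
    rw [not_lt, top_le_iff] at hcon
    have := (eLpNorm_averageGradient_sq_le U).trans_lt h
    rw [hcon] at this
    simp at this
  · obtain ⟨B', hB'⟩ := exists_bound_of_memLp (memLp_diff hU i)
    have hφi : Integrable φ volume := hφ.continuous.integrable_of_hasCompactSupport hφc
    have hψ : Continuous fun x => fderiv ℝ φ x (EuclideanSpace.single i 1) :=
      (hφ.continuous_fderiv (by simp)).clm_apply continuous_const
    have hψi := hψ.integrable_of_hasCompactSupport (μ := volume) (hφc.fderiv_apply ℝ _)
    have hm : Measurable (step U) := measurable_step U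
    have e1 := integral_average_mul (ν := cubeMeasure d) (measurable_step U) (fun x => hB _)
      hψ hψi measurable_toLp
    have e2 := integral_average_mul (ν := cubeMeasure d) (measurable_step (diff i U))
      (fun x => hB' _) hφ.continuous hφi (measurable_face i)
    set Φ : EuclideanSpace ℝ (Fin d) → ℝ := fun z =>
      ∫ y, φ (z - WithLp.toLp 2 (Function.update y i 0)) ∂cubeMeasure d
    have hΦ : Integrable Φ volume :=
      (integrable_comp_sub (ν := cubeMeasure d) hφ.continuous hφi
        (measurable_face i)).integral_prod_left
    have hbd : ∀ (c : EuclideanSpace ℝ (Fin d)) {F : EuclideanSpace ℝ (Fin d) → ℝ},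
        Integrable F volume → Integrable (fun z => step U (z + c) * F z) volume := fun c F hF =>
      Integrable.bdd_mul (c := B) hF (hm.comp (measurable_add_const c)).aestronglyMeasurable
        (Eventually.of_forall fun z => hB _)
    have hbd0 : ∀ {F : EuclideanSpace ℝ (Fin d) → ℝ},
        Integrable F volume → Integrable (fun z => step U z * F z) volume := fun {F} hF => by
      simpa using hbd 0 hF
    have hL : ∫ x, average U x * fderiv ℝ φ x (EuclideanSpace.single i 1) =
        (∫ z, step U z * Φ z) - ∫ z, step U z * Φ (z - EuclideanSpace.single i 1) := by
      rw [← integral_sub (hbd0 hΦ) (hbd0 (hΦ.comp_sub_right _))]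
      refine e1.trans ?_
      congr 1
      funext z
      rw [integral_fderiv_cube hφ hφc i z, mul_sub]
    have hR : ∫ x, averageGradient U x i * φ x =
        (∫ z, step U z * Φ (z - EuclideanSpace.single i 1)) - ∫ z, step U z * Φ z := by
      rw [← integral_add_right_eq_self
        (fun z => step U z * Φ (z - EuclideanSpace.single i 1)) (EuclideanSpace.single i 1)]
      simp only [add_sub_cancel_right]
      rw [← integral_sub (hbd _ hΦ) (hbd0 hΦ)]
      refine e2.trans ?_
      congr 1
      funext z
      rw [step_diff, sub_mul]
    rw [hL, hR]
    ring

/-! ### Sequence spaces -/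

/-- Write c i ^ q as (c i ^ 2) ^ (q/2 - 1) * c i ^ 2 and bound the first factor by the same power of
the whole sum. Thus ℓ² embeds in ℓᵠ with constant one. -/
lemma tsum_rpow_le {ι : Type*} (c : ι → ℝ≥0∞) {q : ℝ} (hq : 2 ≤ q) :
    ∑' i, c i ^ q ≤ (∑' i, c i ^ 2) ^ (q / 2) := by
  set S := ∑' i, c i ^ 2
  have hc : ∀ i, c i ^ q ≤ S ^ (q / 2 - 1) * c i ^ 2 := fun i => by
    have h1 : c i ^ q = (c i ^ 2) ^ (q / 2 - 1) * c i ^ 2 := by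
      calc c i ^ q = (c i ^ 2) ^ (q / 2) := by
            rw [← ENNReal.rpow_two, ← ENNReal.rpow_mul]; congr 1; ring
        _ = (c i ^ 2) ^ (q / 2 - 1 + 1) := by congr 1; ring
        _ = _ := by
          rw [ENNReal.rpow_add_of_nonneg _ _ (by linarith) zero_le_one, ENNReal.rpow_one]
    rw [h1]
    gcongr
    · linarith
    · exact ENNReal.le_tsum (f := fun i => c i ^ 2) i
  calc ∑' i, c i ^ q ≤ ∑' i, S ^ (q / 2 - 1) * c i ^ 2 := ENNReal.tsum_le_tsum hc
    _ = S ^ (q / 2 - 1) * S := ENNReal.tsum_mul_left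
    _ = S ^ (q / 2 - 1 + 1) := by
      rw [ENNReal.rpow_add_of_nonneg _ _ (by linarith) zero_le_one, ENNReal.rpow_one]
    _ = S ^ (q / 2) := by congr 1; ring

lemma sq_rpow_half (x : ℝ≥0∞) (q : ℝ) : (x ^ 2) ^ (q / 2) = x ^ q := by
  rw [← ENNReal.rpow_two, ← ENNReal.rpow_mul]; congr 1; ring

lemma eLpNorm_count_le {ι : Type*} [MeasurableSpace ι] [MeasurableSingletonClass ι] (U : ι → ℝ)
    {q : ℝ} (hq : 2 ≤ q) :
    eLpNorm U (ENNReal.ofReal q) Measure.count ≤ eLpNorm U 2 Measure.count := by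
  have hq0 : 0 < q := by linarith
  rw [← ENNReal.rpow_le_rpow_iff hq0, eLpNorm_ofReal_rpow _ _ hq0, ← sq_rpow_half, eLpNorm_two_sq,
    lintegral_count, lintegral_count]
  exact tsum_rpow_le _ hq

/-! ### Vertex values of functions on the grid -/

lemma edgePoint_zero (k : Fin d → ℤ) (i j : Fin d) : edgePoint (k, i) 0 = edgePoint (k, j) 0 := by
  simp [edgePoint]

lemma edgePoint_one (k : Fin d → ℤ) (i j : Fin d) :
    edgePoint (k, i) 1 = edgePoint (k + Pi.single i 1, j) 0 := by
  apply Subtype.ext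
  ext l
  by_cases h : l = i
  · subst h; simp [edgePoint]
  · simp [edgePoint, h]

lemma exists_edgePoint (x : grid d) : ∃ e : Edge d, ∃ t ∈ Icc (0 : ℝ) 1, x = edgePoint e t := by
  obtain ⟨x, i, hi⟩ := x
  refine ⟨(fun j => ⌊x j⌋, i), Int.fract (x i), ⟨Int.fract_nonneg _, (Int.fract_lt_one _).le⟩, ?_⟩
  apply Subtype.ext
  ext j
  by_cases h : j = i
  · subst h; simp [edgePoint]
  · obtain ⟨n, hn⟩ := hi j h
    simp [edgePoint, h, hn]

/-- The values at the vertices of a function on the grid; the direction only names the edge on which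
the vertex is read. -/
def vertexValue (i : Fin d) (u : grid d → ℝ) (k : Fin d → ℤ) : ℝ := u (edgePoint (k, i) 0)

/-- The norm in `L²` of the derivative on one edge. -/
def edgeEnergy (u : grid d → ℝ) (e : Edge d) : ℝ≥0∞ :=
  eLpNorm (fun t => edgeDeriv u (e, t)) 2 unitMeasure

lemma tsum_edgeEnergy_sq (u : grid d → ℝ) :
    ∑' e, edgeEnergy u e ^ 2 = eLpNorm (edgeDeriv u) 2 (edgeMeasure d) ^ 2 :=
  (eLpNorm_edge_sq _).symm

lemma MemH1Grid.enorm_sub_le {u : grid d → ℝ} (hu : MemH1Grid u) (e : Edge d) {s t : ℝ}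
    (hs : s ∈ Icc (0 : ℝ) 1) (ht : t ∈ Icc (0 : ℝ) 1) :
    ‖u (edgePoint e t) - u (edgePoint e s)‖ₑ ≤ edgeEnergy u e :=
  enorm_sub_le_of_ac' (hu.absolutelyContinuous e) hs ht

/-- The edges have length one, so an increment across an edge is at most the L² norm of u' there;
every edge carries exactly one difference, so no constant is lost. -/
lemma MemH1Grid.sum_diff_vertexValue_le {u : grid d → ℝ} (hu : MemH1Grid u) (j : Fin d) :
    ∑ i, eLpNorm (diff i (vertexValue j u)) 2 Measure.count ^ 2 ≤
      eLpNorm (edgeDeriv u) 2 (edgeMeasure d) ^ 2 := by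
  rw [← tsum_edgeEnergy_sq, ENNReal.summable.tsum_prod' fun _ => ENNReal.summable,
    ENNReal.tsum_comm, tsum_fintype]
  refine Finset.sum_le_sum fun i _ => ?_
  rw [eLpNorm_two_sq, lintegral_count]
  refine ENNReal.tsum_le_tsum fun k => ?_
  gcongr
  have := hu.enorm_sub_le (k, i) (s := 0) (t := 1) (by simp) (by simp)
  rwa [edgePoint_one k i j, edgePoint_zero k i j] at this

lemma MemH1Grid.diff_vertexValue_le {u : grid d → ℝ} (hu : MemH1Grid u) (i j : Fin d) :
    eLpNorm (diff i (vertexValue j u)) 2 Measure.count ≤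
      eLpNorm (edgeDeriv u) 2 (edgeMeasure d) := by
  rw [← ENNReal.pow_le_pow_left_iff two_ne_zero]
  exact (Finset.single_le_sum (f := fun i => eLpNorm (diff i (vertexValue j u)) 2 Measure.count ^ 2)
    (fun _ _ => zero_le) (Finset.mem_univ i)).trans (hu.sum_diff_vertexValue_le j)

/-- The function on the edges that is constant on each edge, with the value of `U` at the base. -/
def baseValue (U : (Fin d → ℤ) → ℝ) (p : Edge d × ℝ) : ℝ := U p.1.1

lemma aestronglyMeasurable_baseValue (U : (Fin d → ℤ) → ℝ) :
    AEStronglyMeasurable (baseValue U) (edgeMeasure d) :=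
  ((measurable_of_countable fun e : Edge d => U e.1).comp measurable_fst).aestronglyMeasurable

/-- Every vertex is the base of d edges of length one. This factor is the origin of the power of d
in the threshold. -/
lemma eLpNorm_baseValue_rpow (U : (Fin d → ℤ) → ℝ) {q : ℝ} (hq : 0 < q) :
    eLpNorm (baseValue U) (ENNReal.ofReal q) (edgeMeasure d) ^ q =
      d * eLpNorm U (ENNReal.ofReal q) Measure.count ^ q := by
  rw [eLpNorm_ofReal_rpow _ _ hq, eLpNorm_ofReal_rpow _ _ hq, lintegral_edgeMeasure,
    lintegral_count]
  simp only [baseValue, lintegral_const, measure_univ, mul_one]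
  rw [ENNReal.summable.tsum_prod' fun _ => ENNReal.summable]
  simp [ENNReal.tsum_mul_left]

lemma eLpNorm_baseValue (U : (Fin d → ℤ) → ℝ) {q : ℝ} (hq : 0 < q) :
    eLpNorm (baseValue U) (ENNReal.ofReal q) (edgeMeasure d) =
      (d : ℝ≥0∞) ^ (1 / q) * eLpNorm U (ENNReal.ofReal q) Measure.count := by
  apply ENNReal.rpow_left_injective hq.ne'
  simp only
  rw [eLpNorm_baseValue_rpow U hq,
    ENNReal.mul_rpow_of_nonneg _ _ hq.le, ← ENNReal.rpow_mul, one_div_mul_cancel hq.ne',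
    ENNReal.rpow_one]

/-- On each edge the oscillation of u is at most the edge energy; the energies are then summed in ℓᵠ
and compared with ℓ². -/
lemma MemH1Grid.eLpNorm_sub_baseValue_le {u : grid d → ℝ} (hu : MemH1Grid u) (j : Fin d) {q : ℝ}
    (hq : 2 ≤ q) :
    eLpNorm (onEdges u - baseValue (vertexValue j u)) (ENNReal.ofReal q) (edgeMeasure d) ≤
      eLpNorm (edgeDeriv u) 2 (edgeMeasure d) := by
  have hq0 : 0 < q := by linarith
  rw [← ENNReal.rpow_le_rpow_iff hq0, eLpNorm_ofReal_rpow _ _ hq0, ← sq_rpow_half,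
    ← tsum_edgeEnergy_sq, lintegral_edgeMeasure]
  refine le_trans (ENNReal.tsum_le_tsum fun e => ?_) (tsum_rpow_le _ hq)
  calc ∫⁻ t, ‖(onEdges u - baseValue (vertexValue j u)) (e, t)‖ₑ ^ q ∂unitMeasure
      ≤ ∫⁻ _t, edgeEnergy u e ^ q ∂unitMeasure := by
        refine setLIntegral_mono' measurableSet_Icc fun t ht => ?_
        gcongr
        have := hu.enorm_sub_le e (s := 0) (t := t) (by simp) ht
        obtain ⟨k, i⟩ := e
        rw [edgePoint_zero k i j] at this
        exact this
    _ = edgeEnergy u e ^ q := by simp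

lemma MemH1Grid.eLpNorm_le_vertexValue {u : grid d → ℝ} (hu : MemH1Grid u) (j : Fin d) {q : ℝ}
    (hq : 2 ≤ q) :
    eLpNorm (onEdges u) (ENNReal.ofReal q) (edgeMeasure d) ≤
      (d : ℝ≥0∞) ^ (1 / q) * eLpNorm (vertexValue j u) (ENNReal.ofReal q) Measure.count +
        eLpNorm (edgeDeriv u) 2 (edgeMeasure d) := by
  have hm := aestronglyMeasurable_baseValue (vertexValue j u)
  have h := eLpNorm_add_le (hu.memLp.1.sub hm) hm (p := ENNReal.ofReal q)
    (by simp only [ENNReal.one_le_ofReal]; linarith)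
  rw [sub_add_cancel, eLpNorm_baseValue _ (by linarith)] at h
  rw [add_comm]
  exact h.trans (by gcongr; exact hu.eLpNorm_sub_baseValue_le j hq)

lemma MemH1Grid.vertexValue_le {u : grid d → ℝ} (hu : MemH1Grid u) (j : Fin d) :
    (d : ℝ≥0∞) ^ (1 / 2 : ℝ) * eLpNorm (vertexValue j u) 2 Measure.count ≤
      eLpNorm (onEdges u) 2 (edgeMeasure d) + eLpNorm (edgeDeriv u) 2 (edgeMeasure d) := by
  have hm := aestronglyMeasurable_baseValue (vertexValue j u)
  have h := eLpNorm_sub_le hu.memLp.1 (hu.memLp.1.sub hm) (p := 2) (by simp)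
  have h2 := hu.eLpNorm_sub_baseValue_le j (q := 2) le_rfl
  have h3 := eLpNorm_baseValue (vertexValue j u) (q := 2) two_pos
  rw [ENNReal.ofReal_ofNat] at h2 h3
  rw [sub_sub_cancel, h3] at h
  exact h.trans (by gcongr)

lemma MemH1Grid.memLp_vertexValue {u : grid d → ℝ} (hu : MemH1Grid u) (j : Fin d) :
    MemLp (vertexValue j u) 2 Measure.count := by
  refine ⟨(measurable_of_countable _).aestronglyMeasurable, ?_⟩
  have h := (hu.vertexValue_le j).trans_lt (ENNReal.add_lt_top.2 ⟨hu.memLp.2, hu.memLp_deriv.2⟩)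
  refine (le_mul_of_one_le_left zero_le ?_).trans_lt h
  refine ENNReal.one_le_rpow ?_ (by norm_num)
  exact_mod_cast j.pos

lemma MemH1Grid.memLp_rpow {u : grid d → ℝ} (hu : MemH1Grid u) (j : Fin d) {q : ℝ}
    (hq : 2 ≤ q) : MemLp (onEdges u) (ENNReal.ofReal q) (edgeMeasure d) := by
  refine ⟨hu.memLp.1, (hu.eLpNorm_le_vertexValue j hq).trans_lt ?_⟩
  refine ENNReal.add_lt_top.2 ⟨ENNReal.mul_lt_top ?_ ?_, hu.memLp_deriv.2⟩
  · exact ENNReal.rpow_lt_top_of_nonneg (by positivity) (by simp)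
  · exact (eLpNorm_count_le _ hq).trans_lt (hu.memLp_vertexValue j).2

/-! ### The Gagliardo–Nirenberg inequality of `ℝᵈ` for the vertex values -/

lemma eLpNorm_rpow_le_euclideanConstant {q : ℝ} (hq : 0 < q)
    (hK : euclideanConstant d q ≠ ⊤) {v : EuclideanSpace ℝ (Fin d) → ℝ}
    {g : EuclideanSpace ℝ (Fin d) → EuclideanSpace ℝ (Fin d)} (h : IsH1WithGradient v g)
    (ha : 0 ≤ (d : ℝ) + (2 - d) * (q / 2)) (hb : 0 ≤ (q / 2 - 1) * (d : ℝ)) :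
    eLpNorm v (ENNReal.ofReal q) volume ^ q ≤ euclideanConstant d q *
      (eLpNorm v 2 volume ^ ((d : ℝ) + (2 - d) * (q / 2)) *
        eLpNorm g 2 volume ^ ((q / 2 - 1) * (d : ℝ))) := by
  by_cases h0 : v =ᵐ[volume] 0
  · rw [eLpNorm_congr_ae h0, eLpNorm_zero, ENNReal.zero_rpow_of_pos hq]
    exact zero_le
  · have hle : euclideanQuotient q v g ≤ euclideanConstant d q :=
      le_iSup₂_of_le v g (le_iSup₂_of_le h h0 le_rfl)
    refine (ENNReal.div_le_iff_le_mul (Or.inr hK) (Or.inl ?_)).1 hle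
    exact ENNReal.mul_ne_top (ENNReal.rpow_ne_top_of_nonneg ha h.memLp.2.ne)
      (ENNReal.rpow_ne_top_of_nonneg hb h.memLp_gradient.2.ne)

/-- Up to a multiple of `‖u'‖₂`, the norm in `Lᵠ` of a function on the grid is controlled by the
Gagliardo–Nirenberg constant of the Euclidean space. -/
theorem MemH1Grid.eLpNorm_le_euclideanConstant {u : grid d → ℝ} (hu : MemH1Grid u) (j : Fin d)
    {q : ℝ} (hq : 2 ≤ q) (hK : euclideanConstant d q ≠ ⊤)
    (ha : 0 ≤ (d : ℝ) + (2 - d) * (q / 2)) (hb : 0 ≤ (q / 2 - 1) * (d : ℝ)) :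
    eLpNorm (onEdges u) (ENNReal.ofReal q) (edgeMeasure d) ≤
      (d : ℝ≥0∞) ^ (1 / q) * ((euclideanConstant d q *
        (eLpNorm (vertexValue j u) 2 Measure.count ^ ((d : ℝ) + (2 - d) * (q / 2)) *
          eLpNorm (edgeDeriv u) 2 (edgeMeasure d) ^ ((q / 2 - 1) * (d : ℝ)))) ^ (1 / q) +
        d * eLpNorm (edgeDeriv u) 2 (edgeMeasure d)) +
      eLpNorm (edgeDeriv u) 2 (edgeMeasure d) := by
  have hq0 : 0 < q := by linarith
  have hq1 : 1 ≤ q := by linarith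
  set U := vertexValue j u with hUdef
  have hU : MemLp U 2 Measure.count := hu.memLp_vertexValue j
  refine (hu.eLpNorm_le_vertexValue j hq).trans ?_
  gcongr
  -- The norm of U is that of its step function, split into the H¹ function `average U`, to which
  -- the inequality of ℝᵈ applies, and an error controlled by differences.
  rw [← eLpNorm_step, ← add_sub_cancel (average U) (step U)]
  refine (eLpNorm_add_le (stronglyMeasurable_average U measurable_toLp).aestronglyMeasurable
    ((measurable_step U).aestronglyMeasurable.sub
      (stronglyMeasurable_average U measurable_toLp).aestronglyMeasurable)
    (by simpa using hq1)).trans (add_le_add ?_ ?_)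
  · rw [← ENNReal.rpow_le_rpow_iff hq0, ← ENNReal.rpow_mul, one_div_mul_cancel hq0.ne',
      ENNReal.rpow_one]
    refine (eLpNorm_rpow_le_euclideanConstant hq0 hK (isH1WithGradient_average hU) ha hb).trans ?_
    gcongr
    · have := eLpNorm_average_le U (p := 2) one_le_two measurable_toLp
      rw [ENNReal.ofReal_ofNat] at this
      exact this
    · rw [← ENNReal.pow_le_pow_left_iff two_ne_zero]
      exact (eLpNorm_averageGradient_sq_le U).trans (hu.sum_diff_vertexValue_le j)
  · refine (eLpNorm_sub_average_le hU hq1).trans ?_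
    calc ∑ i, eLpNorm (diff i U) (ENNReal.ofReal q) Measure.count
        ≤ ∑ _i : Fin d, eLpNorm (edgeDeriv u) 2 (edgeMeasure d) :=
          Finset.sum_le_sum fun i _ => (eLpNorm_count_le _ hq).trans (hu.diff_vertexValue_le i j)
      _ = d * eLpNorm (edgeDeriv u) 2 (edgeMeasure d) := by simp

/-! ### Norms as real numbers -/

/-- The norm of `u` in `L²` of the grid. -/
def normTwo (u : grid d → ℝ) : ℝ := (eLpNorm (onEdges u) 2 (edgeMeasure d)).toReal

/-- The norm of `u'` in `L²` of the grid. -/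
def normDeriv (u : grid d → ℝ) : ℝ := (eLpNorm (edgeDeriv u) 2 (edgeMeasure d)).toReal

/-- The norm of `u` in `Lᵠ` of the grid. -/
def normPow (q : ℝ) (u : grid d → ℝ) : ℝ :=
  (eLpNorm (onEdges u) (ENNReal.ofReal q) (edgeMeasure d)).toReal

lemma normTwo_nonneg (u : grid d → ℝ) : 0 ≤ normTwo u := ENNReal.toReal_nonneg
lemma normDeriv_nonneg (u : grid d → ℝ) : 0 ≤ normDeriv u := ENNReal.toReal_nonneg
lemma normPow_nonneg (q : ℝ) (u : grid d → ℝ) : 0 ≤ normPow q u := ENNReal.toReal_nonneg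

/-- The exponent of `‖u‖₂` in the Gagliardo–Nirenberg quotient. -/
def expTwo (d : ℕ) (q : ℝ) : ℝ := (d : ℝ) + (2 - d) * (q / 2)

/-- The exponent of `‖u'‖₂` in the Gagliardo–Nirenberg quotient. -/
def expDeriv (d : ℕ) (q : ℝ) : ℝ := (q / 2 - 1) * (d : ℝ)

lemma expTwo_add_expDeriv (d : ℕ) (q : ℝ) : expTwo d q + expDeriv d q = q := by
  unfold expTwo expDeriv; ring

/-- The admissible dimensions and exponents. -/
structure Admissible (d : ℕ) (q : ℝ) : Prop where
  two_le : 2 ≤ d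
  two_lt : 2 < q
  le : q ≤ 2 + 4 / (d : ℝ)

namespace Admissible

variable {q : ℝ}

lemma cast_two_le (h : Admissible d q) : (2 : ℝ) ≤ d := by exact_mod_cast h.two_le

lemma expDeriv_pos (h : Admissible d q) : 0 < expDeriv d q :=
  mul_pos (by linarith [h.two_lt]) (by linarith [h.cast_two_le])

/-- With 2 < q this makes the exponent of ‖u'‖₂ smaller than q. Hence the exponent of ‖u‖₂ is
positive, and errors of size ‖u'‖₂ are negligible for small derivatives. -/
lemma expDeriv_le (h : Admissible d q) : expDeriv d q ≤ 2 := by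
  have hd := h.cast_two_le
  have h1 : (q - 2) * d ≤ 4 := by
    have := h.le
    rw [← le_div_iff₀ (by linarith)]; linarith
  unfold expDeriv; nlinarith

lemma expTwo_pos (h : Admissible d q) : 0 < expTwo d q := by
  have := expTwo_add_expDeriv d q
  linarith [h.expDeriv_le, h.two_lt]

/-- A direction of the grid. -/
def direction (h : Admissible d q) : Fin d := ⟨0, by have := h.two_le; omega⟩

end Admissible

/-! ### The maximum norm and nonvanishing -/

lemma MemH1Grid.sq_le {u : grid d → ℝ} (hu : MemH1Grid u) (x : grid d) :
    u x ^ 2 ≤ normTwo u ^ 2 + 2 * (normTwo u * normDeriv u) := by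
  obtain ⟨e, t, ht, rfl⟩ := exists_edgePoint x
  have h := enorm_sq_le_of_ac (hu.absolutelyContinuous e) ht
  have h1 : eLpNorm (fun t => u (edgePoint e t)) 2 unitMeasure ≤
      eLpNorm (onEdges u) 2 (edgeMeasure d) := eLpNorm_edge_le (onEdges u) e
  have h2 : eLpNorm (deriv fun t => u (edgePoint e t)) 2 unitMeasure ≤
      eLpNorm (edgeDeriv u) 2 (edgeMeasure d) := eLpNorm_edge_le (edgeDeriv u) e
  have h3 : ‖u (edgePoint e t)‖ₑ ^ 2 ≤ eLpNorm (onEdges u) 2 (edgeMeasure d) ^ 2 +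
      2 * (eLpNorm (onEdges u) 2 (edgeMeasure d) * eLpNorm (edgeDeriv u) 2 (edgeMeasure d)) :=
    h.trans (by gcongr)
  have hN := hu.memLp.2.ne
  have hD := hu.memLp_deriv.2.ne
  have htop : (2 : ℝ≥0∞) * (eLpNorm (onEdges u) 2 (edgeMeasure d) *
      eLpNorm (edgeDeriv u) 2 (edgeMeasure d)) ≠ ⊤ :=
    ENNReal.mul_ne_top (by simp) (ENNReal.mul_ne_top hN hD)
  have h4 := ENNReal.toReal_mono (ENNReal.add_ne_top.2 ⟨ENNReal.pow_ne_top hN, htop⟩) h3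
  rw [ENNReal.toReal_add (ENNReal.pow_ne_top hN) htop, ENNReal.toReal_mul, ENNReal.toReal_mul,
    ENNReal.toReal_pow, ENNReal.toReal_pow, toReal_enorm, Real.norm_eq_abs, sq_abs] at h4
  simpa [normTwo, normDeriv] using h4

lemma MemH1Grid.normTwo_pos {u : grid d → ℝ} (hu : MemH1Grid u) (h0 : u ≠ 0) : 0 < normTwo u := by
  refine (normTwo_nonneg u).lt_of_ne' fun h => h0 ?_
  funext x
  have := hu.sq_le x
  rw [h] at this
  simpa using this

/-- A nonzero value would repeat along infinitely many lattice points of a line, against square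
summability. -/
lemma eq_zero_of_shift_invariant {U : (Fin d → ℤ) → ℝ} (hU : MemLp U 2 Measure.count) (i : Fin d)
    (h : ∀ k, U (k + Pi.single i 1) = U k) : U = 0 := by
  funext k
  by_contra hk
  have hn : ∀ n : ℕ, U (k + Pi.single i (n : ℤ)) = U k := by
    intro n
    induction n with
    | zero => simp
    | succ n ih =>
      have e : k + Pi.single i ((n + 1 : ℕ) : ℤ) = k + Pi.single i (n : ℤ) + Pi.single i 1 := by
        rw [add_assoc, ← Pi.single_add]
        push_cast; rfl
      rw [e, h, ih]
  have hinj : Function.Injective fun n : ℕ => k + Pi.single i (n : ℤ) := by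
    intro m n hmn
    simpa using congrFun hmn i
  have h1 := ENNReal.tsum_comp_le_tsum_of_injective hinj fun k => ‖U k‖ₑ ^ 2
  simp only [hn] at h1
  rw [ENNReal.tsum_const_eq_top_of_ne_zero (by simpa using hk), ← lintegral_count,
    ← eLpNorm_two_sq, top_le_iff] at h1
  exact ENNReal.pow_ne_top hU.2.ne h1

/-- If u' = 0, then u is constant on every edge, so its vertex values are shift invariant and square
summable. -/
lemma MemH1Grid.normDeriv_pos {u : grid d → ℝ} (hu : MemH1Grid u) (h0 : u ≠ 0) :
    0 < normDeriv u := by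
  refine (normDeriv_nonneg u).lt_of_ne' fun h => h0 ?_
  have hD : eLpNorm (edgeDeriv u) 2 (edgeMeasure d) = 0 :=
    ((ENNReal.toReal_eq_zero_iff _).1 h).resolve_right hu.memLp_deriv.2.ne
  have he : ∀ e, edgeEnergy u e = 0 := fun e =>
    le_antisymm ((eLpNorm_edge_le (edgeDeriv u) e).trans hD.le) zero_le
  have hc : ∀ (e : Edge d) (t : ℝ), t ∈ Icc (0 : ℝ) 1 →
      u (edgePoint e t) = u (edgePoint e 0) := fun e t ht => by
    have := hu.enorm_sub_le e (s := 0) (t := t) (by simp) ht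
    rw [he e, nonpos_iff_eq_zero, enorm_eq_zero, sub_eq_zero] at this
    exact this
  funext x
  obtain ⟨⟨k, i⟩, t, ht, rfl⟩ := exists_edgePoint x
  rw [hc _ t ht]
  have := eq_zero_of_shift_invariant (hu.memLp_vertexValue i) i fun k => by
    have := hc (k, i) 1 (by simp)
    rwa [edgePoint_one k i i] at this
  exact congrFun this k

lemma normPow_rpow {u : grid d → ℝ} {q : ℝ} (hq : 0 < q) :
    normPow q u ^ q = (∫⁻ p, ‖onEdges u p‖ₑ ^ q ∂edgeMeasure d).toReal := by
  rw [normPow, ENNReal.toReal_rpow, eLpNorm_ofReal_rpow _ _ hq]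

lemma normTwo_sq (u : grid d → ℝ) :
    normTwo u ^ 2 = (∫⁻ p, ‖onEdges u p‖ₑ ^ 2 ∂edgeMeasure d).toReal := by
  rw [normTwo, ← ENNReal.toReal_pow, eLpNorm_two_sq]

lemma MemH1Grid.normPow_rpow_le {u : grid d → ℝ} (hu : MemH1Grid u) {q S : ℝ} (hq : 2 < q)
    (hS : 0 ≤ S) (h : ∀ x, |u x| ≤ S) : normPow q u ^ q ≤ S ^ (q - 2) * normTwo u ^ 2 := by
  rw [normPow_rpow (by linarith), normTwo_sq]
  have h1 : ∫⁻ p, ‖onEdges u p‖ₑ ^ q ∂edgeMeasure d ≤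
      ENNReal.ofReal S ^ (q - 2) * ∫⁻ p, ‖onEdges u p‖ₑ ^ 2 ∂edgeMeasure d := by
    rw [← lintegral_const_mul' _ _ (ENNReal.rpow_ne_top_of_nonneg (by linarith) (by simp))]
    refine lintegral_mono fun p => ?_
    have e : ‖onEdges u p‖ₑ ^ q = ‖onEdges u p‖ₑ ^ (q - 2) * ‖onEdges u p‖ₑ ^ 2 := by
      rw [← ENNReal.rpow_two, ← ENNReal.rpow_add_of_nonneg _ _ (by linarith) (by norm_num)]
      congr 1; ring
    simp only
    rw [e]
    gcongr
    rw [← ofReal_norm]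
    exact ENNReal.ofReal_le_ofReal (h _)
  have hfin : ∫⁻ p, ‖onEdges u p‖ₑ ^ 2 ∂edgeMeasure d ≠ ⊤ := by
    rw [← eLpNorm_two_sq]; exact ENNReal.pow_ne_top hu.memLp.2.ne
  have h2 := ENNReal.toReal_mono (ENNReal.mul_ne_top
    (ENNReal.rpow_ne_top_of_nonneg (by linarith) (by simp)) hfin) h1
  rwa [ENNReal.toReal_mul, ← ENNReal.toReal_rpow, ENNReal.toReal_ofReal hS] at h2

/-! ### Linear structure and translations -/

lemma MemH1Grid.edgeDeriv_sub {u v : grid d → ℝ} (hu : MemH1Grid u) (hv : MemH1Grid v) :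
    edgeDeriv (u - v) =ᵐ[edgeMeasure d] edgeDeriv u - edgeDeriv v := by
  rw [EventuallyEq, ae_edgeMeasure_iff]
  intro e
  have h1 := (hu.absolutelyContinuous e).ae_differentiableAt
  have h2 := (hv.absolutelyContinuous e).ae_differentiableAt
  rw [uIcc_of_le zero_le_one] at h1 h2
  refine (ae_restrict_iff' measurableSet_Icc).2 ?_
  filter_upwards [h1, h2] with t h1 h2 ht
  exact deriv_fun_sub (h1 ht) (h2 ht)

lemma MemH1Grid.sub {u v : grid d → ℝ} (hu : MemH1Grid u) (hv : MemH1Grid v) :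
    MemH1Grid (u - v) :=
  ⟨fun e => (hu.absolutelyContinuous e).sub (hv.absolutelyContinuous e), hu.memLp.sub hv.memLp,
    (memLp_congr_ae (hu.edgeDeriv_sub hv)).2 (hu.memLp_deriv.sub hv.memLp_deriv)⟩

lemma edgeDeriv_smul (c : ℝ) (u : grid d → ℝ) : edgeDeriv (c • u) = c • edgeDeriv u := by
  funext p
  exact deriv_const_mul_field c

lemma onEdges_smul (c : ℝ) (u : grid d → ℝ) : onEdges (c • u) = c • onEdges u := rfl

lemma MemH1Grid.smul {u : grid d → ℝ} (hu : MemH1Grid u) (c : ℝ) : MemH1Grid (c • u) :=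
  ⟨fun e => (hu.absolutelyContinuous e).const_mul c, hu.memLp.const_smul c, by
    rw [edgeDeriv_smul]; exact hu.memLp_deriv.const_smul c⟩

lemma normTwo_smul (c : ℝ) (u : grid d → ℝ) : normTwo (c • u) = |c| * normTwo u := by
  simp [normTwo, onEdges_smul, eLpNorm_const_smul]

lemma normDeriv_smul (c : ℝ) (u : grid d → ℝ) : normDeriv (c • u) = |c| * normDeriv u := by
  simp [normDeriv, edgeDeriv_smul, eLpNorm_const_smul]

lemma normPow_smul (q c : ℝ) (u : grid d → ℝ) : normPow q (c • u) = |c| * normPow q u := by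
  simp [normPow, onEdges_smul, eLpNorm_const_smul]

/-- The translation of the grid by an integer vector. -/
def shift (m : Fin d → ℤ) (x : grid d) : grid d :=
  ⟨x.1 + WithLp.toLp 2 fun j => (m j : ℝ), by
    obtain ⟨x, i, hi⟩ := x
    refine ⟨i, fun j hj => ?_⟩
    obtain ⟨n, hn⟩ := hi j hj
    exact ⟨n + m j, by simp [hn]⟩⟩

/-- The translation of the edges by an integer vector. -/
def shiftEdge (m : Fin d → ℤ) (e : Edge d) : Edge d := (e.1 + m, e.2)

lemma shift_edgePoint (m : Fin d → ℤ) (e : Edge d) (t : ℝ) :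
    shift m (edgePoint e t) = edgePoint (shiftEdge m e) t := by
  apply Subtype.ext
  ext j
  simp only [shift, edgePoint, shiftEdge, PiLp.add_apply, Pi.add_apply, Int.cast_add]
  exact add_right_comm _ _ _

lemma measurePreserving_shiftEdge (m : Fin d → ℤ) :
    MeasurePreserving (Prod.map (shiftEdge m) id) (edgeMeasure d) (edgeMeasure d) := by
  refine MeasurePreserving.prod ⟨measurable_of_countable _, ?_⟩ (MeasurePreserving.id _)
  refine Measure.ext_iff_singleton.2 fun e => ?_
  have : shiftEdge m ⁻¹' {e} = {(e.1 - m, e.2)} := by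
    ext f
    simp only [mem_preimage, mem_singleton_iff, shiftEdge, Prod.ext_iff, eq_sub_iff_add_eq]
  rw [Measure.map_apply (measurable_of_countable _) (measurableSet_singleton e), this,
    Measure.count_singleton, Measure.count_singleton]

lemma onEdges_shift (m : Fin d → ℤ) (u : grid d → ℝ) :
    onEdges (u ∘ shift m) = onEdges u ∘ Prod.map (shiftEdge m) id := by
  funext p
  simp [onEdges, shift_edgePoint]

lemma edgeDeriv_shift (m : Fin d → ℤ) (u : grid d → ℝ) :
    edgeDeriv (u ∘ shift m) = edgeDeriv u ∘ Prod.map (shiftEdge m) id := by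
  funext p
  simp [edgeDeriv, shift_edgePoint]

lemma MemH1Grid.comp_shift {u : grid d → ℝ} (hu : MemH1Grid u) (m : Fin d → ℤ) :
    MemH1Grid (u ∘ shift m) := by
  refine ⟨fun e => ?_, ?_, ?_⟩
  · simpa [shift_edgePoint] using hu.absolutelyContinuous (shiftEdge m e)
  · rw [onEdges_shift]; exact hu.memLp.comp_measurePreserving (measurePreserving_shiftEdge m)
  · rw [edgeDeriv_shift]
    exact hu.memLp_deriv.comp_measurePreserving (measurePreserving_shiftEdge m)

lemma MemH1Grid.normTwo_shift {u : grid d → ℝ} (hu : MemH1Grid u) (m : Fin d → ℤ) :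
    normTwo (u ∘ shift m) = normTwo u := by
  rw [normTwo, onEdges_shift, eLpNorm_comp_measurePreserving hu.memLp.1
    (measurePreserving_shiftEdge m), normTwo]

lemma MemH1Grid.normDeriv_shift {u : grid d → ℝ} (hu : MemH1Grid u) (m : Fin d → ℤ) :
    normDeriv (u ∘ shift m) = normDeriv u := by
  rw [normDeriv, edgeDeriv_shift, eLpNorm_comp_measurePreserving hu.memLp_deriv.1
    (measurePreserving_shiftEdge m), normDeriv]

lemma MemH1Grid.normPow_shift {u : grid d → ℝ} (hu : MemH1Grid u) (q : ℝ) (m : Fin d → ℤ) :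
    normPow q (u ∘ shift m) = normPow q u := by
  rw [normPow, onEdges_shift, eLpNorm_comp_measurePreserving hu.memLp.1
    (measurePreserving_shiftEdge m), normPow]

/-! ### The quotient as a real number -/

/-- The Gagliardo–Nirenberg quotient on the grid as a real number. -/
def realQuotient (q : ℝ) (u : grid d → ℝ) : ℝ :=
  normPow q u ^ q / (normTwo u ^ expTwo d q * normDeriv u ^ expDeriv d q)

lemma MemH1Grid.gridQuotient_eq {u : grid d → ℝ} (hu : MemH1Grid u) (h0 : u ≠ 0) {q : ℝ}
    (h : Admissible d q) : gridQuotient q u = ENNReal.ofReal (realQuotient q u) := by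
  have hN := hu.normTwo_pos h0
  have hD := hu.normDeriv_pos h0
  have hP := hu.memLp_rpow h.direction h.two_lt.le
  have e1 : eLpNorm (onEdges u) 2 (edgeMeasure d) = ENNReal.ofReal (normTwo u) :=
    (ENNReal.ofReal_toReal hu.memLp.2.ne).symm
  have e2 : eLpNorm (edgeDeriv u) 2 (edgeMeasure d) = ENNReal.ofReal (normDeriv u) :=
    (ENNReal.ofReal_toReal hu.memLp_deriv.2.ne).symm
  have e3 : eLpNorm (onEdges u) (ENNReal.ofReal q) (edgeMeasure d) =
      ENNReal.ofReal (normPow q u) := (ENNReal.ofReal_toReal hP.2.ne).symm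
  have hq := h.two_lt
  rw [gridQuotient, realQuotient, e1, e2, e3, ENNReal.ofReal_rpow_of_pos hN,
    ENNReal.ofReal_rpow_of_pos hD, ← ENNReal.ofReal_mul (by positivity),
    ENNReal.ofReal_rpow_of_nonneg (normPow_nonneg _ _) (by linarith),
    ← ENNReal.ofReal_div_of_pos (by positivity)]
  rfl

lemma realQuotient_nonneg (q : ℝ) (u : grid d → ℝ) : 0 ≤ realQuotient q u :=
  div_nonneg (Real.rpow_nonneg (normPow_nonneg _ _) _)
    (mul_nonneg (Real.rpow_nonneg (normTwo_nonneg _) _)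
      (Real.rpow_nonneg (normDeriv_nonneg _) _))

lemma realQuotient_smul (q : ℝ) {c : ℝ} (hc : c ≠ 0) (u : grid d → ℝ) :
    realQuotient q (c • u) = realQuotient q u := by
  have hc' : 0 < |c| := abs_pos.2 hc
  rw [realQuotient, normPow_smul, normTwo_smul, normDeriv_smul,
    Real.mul_rpow hc'.le (normPow_nonneg _ _), Real.mul_rpow hc'.le (normTwo_nonneg _),
    Real.mul_rpow hc'.le (normDeriv_nonneg _), mul_mul_mul_comm, ← Real.rpow_add hc',
    expTwo_add_expDeriv, mul_div_mul_left _ _ (by positivity), realQuotient]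

/-! ### Functions with large derivative -/

/-- Interpolating Lᵠ between L² and the one-dimensional bound of the maximum uses only the power q/2
- 1 of ‖u'‖₂, while the quotient divides by the power (q/2 - 1)d. The surplus is a decaying power of
‖u'‖₂/‖u‖₂. -/
lemma MemH1Grid.realQuotient_le_of_le_normDeriv {u : grid d → ℝ} (hu : MemH1Grid u) (h0 : u ≠ 0)
    {q : ℝ} (h : Admissible d q) {δ : ℝ} (hδ : 0 < δ) (hle : δ * normTwo u ≤ normDeriv u) :
    realQuotient q u ≤ (1 / δ + 2) ^ (q / 2 - 1) *
      (normTwo u / normDeriv u) ^ ((q / 2 - 1) * ((d : ℝ) - 1)) := by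
  have hN := hu.normTwo_pos h0
  have hD := hu.normDeriv_pos h0
  have hq := h.two_lt
  set l := normTwo u
  set D := normDeriv u
  set C := 1 / δ + 2
  have hC : 0 < C := by positivity
  -- Since l ≤ D/δ, the term l² is absorbed in lD/δ, whence the constant C = 1/δ + 2.
  have hsup : ∀ x, |u x| ≤ (C * (l * D)) ^ (1 / 2 : ℝ) := fun x => by
    rw [← Real.sqrt_eq_rpow]
    refine Real.abs_le_sqrt ((hu.sq_le x).trans ?_)
    have : l ≤ 1 / δ * D := by rw [one_div, ← div_eq_inv_mul, le_div_iff₀ hδ]; linarith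
    have : l * l ≤ l * (1 / δ * D) := by gcongr
    simp only [C]
    nlinarith
  have h1 := hu.normPow_rpow_le hq (by positivity) hsup
  rw [← Real.rpow_mul (by positivity), show 1 / 2 * (q - 2) = q / 2 - 1 by ring,
    Real.mul_rpow hC.le (by positivity), Real.mul_rpow hN.le hD.le] at h1
  rw [realQuotient, div_le_iff₀ (by positivity), Real.div_rpow hN.le hD.le]
  refine h1.trans (le_of_eq ?_)
  have e1 : l ^ (q / 2 - 1) * l ^ 2 = l ^ ((q / 2 - 1) * ((d : ℝ) - 1)) * l ^ expTwo d q := by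
    rw [← Real.rpow_two, ← Real.rpow_add hN, ← Real.rpow_add hN]
    congr 1; unfold expTwo; ring
  have e2 : D ^ expDeriv d q = D ^ (q / 2 - 1) * D ^ ((q / 2 - 1) * ((d : ℝ) - 1)) := by
    rw [← Real.rpow_add hD]
    congr 1; unfold expDeriv; ring
  have hDk : D ^ ((q / 2 - 1) * ((d : ℝ) - 1)) ≠ 0 := by positivity
  calc C ^ (q / 2 - 1) * (l ^ (q / 2 - 1) * D ^ (q / 2 - 1)) * l ^ 2
      = C ^ (q / 2 - 1) * (l ^ (q / 2 - 1) * l ^ 2) * D ^ (q / 2 - 1) := by ring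
    _ = C ^ (q / 2 - 1) * (l ^ ((q / 2 - 1) * ((d : ℝ) - 1)) /
          D ^ ((q / 2 - 1) * ((d : ℝ) - 1))) * (l ^ expTwo d q * D ^ expDeriv d q) := by
        rw [e1, e2]; field_simp

lemma Admissible.gap_pos {q : ℝ} (h : Admissible d q) : 0 < (q / 2 - 1) * ((d : ℝ) - 1) :=
  mul_pos (by linarith [h.two_lt]) (by linarith [h.cast_two_le])

lemma exists_realQuotient_le_of_le_normDeriv {q : ℝ} (h : Admissible d q) {δ : ℝ} (hδ : 0 < δ) :
    ∃ C, ∀ u : grid d → ℝ, MemH1Grid u → u ≠ 0 → δ * normTwo u ≤ normDeriv u →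
      realQuotient q u ≤ C := by
  refine ⟨(1 / δ + 2) ^ (q / 2 - 1) * (1 / δ) ^ ((q / 2 - 1) * ((d : ℝ) - 1)),
    fun u hu h0 hle => (hu.realQuotient_le_of_le_normDeriv h0 h hδ hle).trans ?_⟩
  have hN := hu.normTwo_pos h0
  have hD := hu.normDeriv_pos h0
  have hr : normTwo u / normDeriv u ≤ 1 / δ := by rw [div_le_div_iff₀ hD hδ]; linarith
  have := h.gap_pos.le
  exact mul_le_mul_of_nonneg_left (Real.rpow_le_rpow (by positivity) hr this) (by positivity)

lemma exists_realQuotient_le_of_large_normDeriv {q : ℝ} (h : Admissible d q) {c : ℝ}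
    (hc : 0 < c) :
    ∃ M, ∀ u : grid d → ℝ, MemH1Grid u → u ≠ 0 → M * normTwo u ≤ normDeriv u →
      realQuotient q u ≤ c := by
  have ht := (tendsto_rpow_neg_atTop h.gap_pos).const_mul ((1 / (1 : ℝ) + 2) ^ (q / 2 - 1))
  rw [mul_zero] at ht
  obtain ⟨M, hM, hM1⟩ := ((ht.eventually (gt_mem_nhds hc)).and (eventually_ge_atTop 1)).exists
  have hM0 : 0 < M := by linarith
  refine ⟨M, fun u hu h0 hle => ?_⟩
  have hN := hu.normTwo_pos h0
  have hD := hu.normDeriv_pos h0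
  have hg := h.gap_pos.le
  refine (hu.realQuotient_le_of_le_normDeriv h0 h one_pos ?_).trans (le_trans ?_ hM.le)
  · exact le_trans (by gcongr) hle
  · rw [Real.rpow_neg hM0.le, ← Real.inv_rpow hM0.le]
    gcongr
    rw [inv_eq_one_div, div_le_div_iff₀ hD hM0]; linarith

/-! ### Functions with small derivative -/

lemma MemH1Grid.normPow_le {u : grid d → ℝ} (hu : MemH1Grid u) {q : ℝ} (h : Admissible d q)
    (hK : euclideanConstant d q ≠ ⊤) :
    normPow q u ≤ ((d : ℝ) ^ (((d : ℝ) - 2) * (q - 2) / 4) * (euclideanConstant d q).toReal *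
        ((normTwo u + normDeriv u) ^ expTwo d q * normDeriv u ^ expDeriv d q)) ^ (1 / q) +
      ((d : ℝ) ^ (1 / q) * d + 1) * normDeriv u := by
  have hq := h.two_lt
  have hd := h.cast_two_le
  have hd0 : (0 : ℝ) < d := by linarith
  have ha := h.expTwo_pos.le
  have hb := h.expDeriv_pos.le
  have h1 := hu.eLpNorm_le_euclideanConstant h.direction hq.le hK ha hb
  have h2 := hu.vertexValue_le h.direction
  have hN := hu.memLp.2.ne
  have hD := hu.memLp_deriv.2.ne
  have hU := (hu.memLp_vertexValue h.direction).2.ne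
  set U := eLpNorm (vertexValue h.direction u) 2 Measure.count
  set K := euclideanConstant d q
  have hX : K * (U ^ expTwo d q * eLpNorm (edgeDeriv u) 2 (edgeMeasure d) ^ expDeriv d q) ≠ ⊤ :=
    ENNReal.mul_ne_top hK (ENNReal.mul_ne_top (ENNReal.rpow_ne_top_of_nonneg ha hU)
      (ENNReal.rpow_ne_top_of_nonneg hb hD))
  have hX' := ENNReal.rpow_ne_top_of_nonneg (show 0 ≤ 1 / q by positivity) hX
  have hdD := ENNReal.mul_ne_top (ENNReal.natCast_ne_top d) hD
  have hdq : (d : ℝ≥0∞) ^ (1 / q) ≠ ⊤ := ENNReal.rpow_ne_top_of_nonneg (by positivity) (by simp)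
  have hsum := ENNReal.mul_ne_top hdq (ENNReal.add_ne_top.2 ⟨hX', hdD⟩)
  have h3 := ENNReal.toReal_mono (ENNReal.add_ne_top.2 ⟨hsum, hD⟩) h1
  have h4 := ENNReal.toReal_mono (ENNReal.add_ne_top.2 ⟨hN, hD⟩) h2
  rw [ENNReal.toReal_add hN hD, ENNReal.toReal_mul, ← ENNReal.toReal_rpow,
    ENNReal.toReal_natCast] at h4
  change _ ≤ normTwo u + normDeriv u at h4
  rw [ENNReal.toReal_add hsum hD, ENNReal.toReal_mul, ENNReal.toReal_add hX' hdD,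
    ENNReal.toReal_mul, ← ENNReal.toReal_rpow, ← ENNReal.toReal_rpow, ENNReal.toReal_mul,
    ENNReal.toReal_mul, ← ENNReal.toReal_rpow, ← ENNReal.toReal_rpow,
    ENNReal.toReal_natCast] at h3
  change normPow q u ≤ (d : ℝ) ^ (1 / q) * ((K.toReal * (U.toReal ^ expTwo d q *
    normDeriv u ^ expDeriv d q)) ^ (1 / q) + d * normDeriv u) + normDeriv u at h3
  -- The factor d from the edges at a vertex meets d^(-1/2) for each power of ‖U‖₂, and 1 - `expTwo
  -- d q`/2 = (d - 2)(q - 2)/4.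
  have hA : (d : ℝ) * U.toReal ^ expTwo d q ≤
      (d : ℝ) ^ (((d : ℝ) - 2) * (q - 2) / 4) * (normTwo u + normDeriv u) ^ expTwo d q := by
    calc (d : ℝ) * U.toReal ^ expTwo d q
        = (d : ℝ) ^ (((d : ℝ) - 2) * (q - 2) / 4) *
            ((d : ℝ) ^ (1 / 2 : ℝ) * U.toReal) ^ expTwo d q := by
          rw [Real.mul_rpow (by positivity) ENNReal.toReal_nonneg, ← Real.rpow_mul hd0.le,
            ← mul_assoc, ← Real.rpow_add hd0]
          congr 1
          rw [show ((d : ℝ) - 2) * (q - 2) / 4 + 1 / 2 * expTwo d q = 1 by unfold expTwo; ring,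
            Real.rpow_one]
      _ ≤ _ := by gcongr
  have hDn := normDeriv_nonneg u
  have hmain : (d : ℝ) ^ (1 / q) * (K.toReal * (U.toReal ^ expTwo d q *
      normDeriv u ^ expDeriv d q)) ^ (1 / q) ≤
      ((d : ℝ) ^ (((d : ℝ) - 2) * (q - 2) / 4) * K.toReal *
        ((normTwo u + normDeriv u) ^ expTwo d q * normDeriv u ^ expDeriv d q)) ^ (1 / q) := by
    rw [← Real.mul_rpow hd0.le (by positivity)]
    refine Real.rpow_le_rpow (by positivity) ?_ (by positivity)
    calc (d : ℝ) * (K.toReal * (U.toReal ^ expTwo d q * normDeriv u ^ expDeriv d q))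
        = (d * U.toReal ^ expTwo d q) * (K.toReal * normDeriv u ^ expDeriv d q) := by ring
      _ ≤ ((d : ℝ) ^ (((d : ℝ) - 2) * (q - 2) / 4) * (normTwo u + normDeriv u) ^ expTwo d q) *
          (K.toReal * normDeriv u ^ expDeriv d q) := by gcongr
      _ = _ := by ring
  linarith

theorem exists_realQuotient_le_of_small_normDeriv {q : ℝ} (h : Admissible d q)
    (hK : euclideanConstant d q ≠ ⊤) {c : ℝ}
    (hc : (d : ℝ) ^ (((d : ℝ) - 2) * (q - 2) / 4) * (euclideanConstant d q).toReal < c) :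
    ∃ δ, 0 < δ ∧ ∀ u : grid d → ℝ, MemH1Grid u → u ≠ 0 → normDeriv u ≤ δ * normTwo u →
      realQuotient q u ≤ c := by
  have hq := h.two_lt
  have hq0 : 0 < q := by linarith
  have ha := h.expTwo_pos
  have hb := h.expDeriv_pos
  have hbq : 0 < 1 - expDeriv d q / q := by
    rw [sub_pos, div_lt_one hq0]; linarith [h.expDeriv_le]
  set Q := (d : ℝ) ^ (((d : ℝ) - 2) * (q - 2) / 4) * (euclideanConstant d q).toReal
  have hQ : 0 ≤ Q := by positivity
  have hc0 : 0 < c := hQ.trans_lt hc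
  set C := (d : ℝ) ^ (1 / q) * d + 1
  have hC : 0 ≤ C := by positivity
  -- H(r) is the bound of `normPow_le` divided by r^(b/q) l, where b = `expDeriv d q` and r = D/l.
  -- Since b < q, the error term vanishes at r = 0, where only Q^(1/q) remains.
  let H : ℝ → ℝ := fun r => (Q * (1 + r) ^ expTwo d q) ^ (1 / q) + C * r ^ (1 - expDeriv d q / q)
  have hH : Continuous H := by
    refine Continuous.add ?_ ?_
    · refine Continuous.rpow_const ?_ fun x => Or.inr (by positivity)
      refine continuous_const.mul (Continuous.rpow_const (by fun_prop) fun x => Or.inr ha.le)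
    · exact continuous_const.mul (Continuous.rpow_const continuous_id fun x => Or.inr hbq.le)
  have hH0 : H 0 < c ^ (1 / q) := by
    simp only [H, add_zero, Real.one_rpow, mul_one, Real.zero_rpow hbq.ne', mul_zero]
    exact Real.rpow_lt_rpow hQ hc (by positivity)
  obtain ⟨δ, hδ, hball⟩ := Metric.eventually_nhds_iff.1 (hH.continuousAt.eventually_lt_const hH0)
  refine ⟨δ / 2, by positivity, fun u hu h0 hle => ?_⟩
  have hN := hu.normTwo_pos h0
  have hD := hu.normDeriv_pos h0
  set l := normTwo u
  set D := normDeriv u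
  obtain ⟨r, hr⟩ : ∃ r, r = D / l := ⟨_, rfl⟩
  have hr0 : 0 < r := by rw [hr]; positivity
  have hDr : D = r * l := by rw [hr]; field_simp
  have hrδ : r ≤ δ / 2 := by rw [hr, div_le_iff₀ hN]; exact hle
  have hHr : H r < c ^ (1 / q) := hball (by
    rw [Real.dist_eq, sub_zero, abs_of_pos hr0]; linarith)
  have hP := hu.normPow_le h hK
  change normPow q u ≤ (Q * ((l + D) ^ expTwo d q * D ^ expDeriv d q)) ^ (1 / q) + C * D at hP
  have hlq : l ^ expTwo d q * l ^ expDeriv d q = l ^ q := by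
    rw [← Real.rpow_add hN, expTwo_add_expDeriv]
  have e1 : (Q * ((l + D) ^ expTwo d q * D ^ expDeriv d q)) ^ (1 / q) =
      (Q * (1 + r) ^ expTwo d q) ^ (1 / q) * (r ^ (expDeriv d q / q) * l) := by
    have : Q * ((l + D) ^ expTwo d q * D ^ expDeriv d q) =
        Q * (1 + r) ^ expTwo d q * (r ^ expDeriv d q * l ^ q) := by
      rw [hDr, show l + r * l = (1 + r) * l by ring, Real.mul_rpow (by positivity) hN.le,
        Real.mul_rpow hr0.le hN.le, ← hlq]
      ring
    rw [this, Real.mul_rpow (y := r ^ expDeriv d q * l ^ q) (by positivity) (by positivity),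
      Real.mul_rpow (x := r ^ expDeriv d q) (by positivity) (by positivity),
      ← Real.rpow_mul hr0.le, ← Real.rpow_mul hN.le, mul_one_div_cancel hq0.ne', Real.rpow_one, mul_one_div]
  have e2 : C * D = C * r ^ (1 - expDeriv d q / q) * (r ^ (expDeriv d q / q) * l) := by
    have : r ^ (1 - expDeriv d q / q) * r ^ (expDeriv d q / q) = r := by
      rw [← Real.rpow_add hr0, sub_add_cancel, Real.rpow_one]
    rw [hDr]
    calc C * (r * l) = C * ((r ^ (1 - expDeriv d q / q) * r ^ (expDeriv d q / q)) * l) := by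
          rw [this]
      _ = _ := by ring
  have hP2 : normPow q u ≤ c ^ (1 / q) * (r ^ (expDeriv d q / q) * l) := by
    refine hP.trans ?_
    rw [e1, e2, ← add_mul]
    gcongr
  have hP3 := Real.rpow_le_rpow (normPow_nonneg q u) hP2 hq0.le
  rw [Real.mul_rpow (by positivity) (by positivity), Real.mul_rpow (by positivity) hN.le,
    ← Real.rpow_mul hc0.le, ← Real.rpow_mul hr0.le, one_div_mul_cancel hq0.ne', Real.rpow_one,
    div_mul_cancel₀ _ hq0.ne'] at hP3
  rw [realQuotient, div_le_iff₀ (by positivity)]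
  refine hP3.trans (le_of_eq ?_)
  change _ = c * (l ^ expTwo d q * D ^ expDeriv d q)
  rw [hDr, Real.mul_rpow hr0.le hN.le, ← hlq]
  ring

/-! ### Weak limits -/

instance (d : ℕ) : SigmaFinite (edgeMeasure d) := by unfold edgeMeasure; infer_instance

/-- Riesz representation identifies L² with its dual, where bounded sets are weak-* sequentially
compact by separability. -/
lemma exists_weak_limit {α : Type*} [MeasurableSpace α] {μ : Measure α}
    [TopologicalSpace.SeparableSpace (Lp ℝ 2 μ)] {f : ℕ → α → ℝ} (hf : ∀ n, MemLp (f n) 2 μ)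
    {C : ℝ} (hC : ∀ n, (eLpNorm (f n) 2 μ).toReal ≤ C) :
    ∃ (φ : ℕ → ℕ) (g : α → ℝ), StrictMono φ ∧ MemLp g 2 μ ∧ ∀ h : α → ℝ, MemLp h 2 μ →
      Tendsto (fun n => ∫ x, f (φ n) x * h x ∂μ) atTop (𝓝 (∫ x, g x * h x ∂μ)) := by
  let F : ℕ → Lp ℝ 2 μ := fun n => (hf n).toLp
  have hF : ∀ n, ‖F n‖ ≤ C := fun n => by simpa [F, Lp.norm_toLp] using hC n
  let T : ℕ → WeakDual ℝ (Lp ℝ 2 μ) := fun n =>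
    WeakDual.toStrongDual.symm (InnerProductSpace.toDual ℝ (Lp ℝ 2 μ) (F n))
  have hT : ∀ n, T n ∈ WeakDual.toStrongDual ⁻¹'
      Metric.closedBall (0 : StrongDual ℝ (Lp ℝ 2 μ)) C := fun n => by
    simp only [T, mem_preimage, LinearEquiv.apply_symm_apply, mem_closedBall_zero_iff]
    rw [LinearIsometryEquiv.norm_map]
    exact hF n
  obtain ⟨x, -, φ, hφ, hlim⟩ := WeakDual.isSeqCompact_closedBall ℝ (Lp ℝ 2 μ) 0 C hT
  set G : Lp ℝ 2 μ := (InnerProductSpace.toDual ℝ (Lp ℝ 2 μ)).symm (WeakDual.toStrongDual x)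
  refine ⟨φ, G, hφ, Lp.memLp G, fun h hh => ?_⟩
  have h1 : Tendsto (fun n => T (φ n) hh.toLp) atTop (𝓝 (x hh.toLp)) :=
    ((WeakBilin.eval_continuous _ _).tendsto x).comp hlim
  have e1 : ∀ n, T n hh.toLp = ∫ y, f n y * h y ∂μ := fun n => by
    have : T n hh.toLp = inner ℝ (F n) hh.toLp := rfl
    rw [this, L2.inner_def]
    refine integral_congr_ae ?_
    filter_upwards [(hf n).coeFn_toLp, hh.coeFn_toLp] with y h1 h2
    simp only [F, h1, h2, RCLike.inner_apply, conj_trivial]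
    ring
  have e2 : x hh.toLp = ∫ y, G y * h y ∂μ := by
    have : x hh.toLp = inner ℝ G hh.toLp := by
      rw [InnerProductSpace.toDual_symm_apply]; rfl
    rw [this, L2.inner_def]
    refine integral_congr_ae ?_
    filter_upwards [hh.coeFn_toLp] with y h2
    simp only [h2, RCLike.inner_apply, conj_trivial]
    ring
  simp_rw [e1, e2] at h1
  exact h1

/-! ### Integrals along the edges -/

/-- The indicator function of the initial part of length `t` of an edge. -/
def edgeIndicator (e : Edge d) (t : ℝ) : Edge d × ℝ → ℝ := indicator ({e} ×ˢ Icc 0 t) 1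

lemma measurableSet_edgePart (e : Edge d) (t : ℝ) :
    MeasurableSet (({e} : Set (Edge d)) ×ˢ Icc 0 t) :=
  (measurableSet_singleton e).prod measurableSet_Icc

lemma edgeMeasure_edgePart_lt_top (e : Edge d) (t : ℝ) :
    edgeMeasure d (({e} : Set (Edge d)) ×ˢ Icc 0 t) < ⊤ := by
  rw [edgeMeasure, Measure.prod_prod, Measure.count_singleton, one_mul]
  exact measure_lt_top _ _

lemma memLp_edgeIndicator (e : Edge d) (t : ℝ) :
    MemLp (edgeIndicator e t) 2 (edgeMeasure d) :=
  memLp_indicator_const 2 (measurableSet_edgePart e t) 1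
    (Or.inr (edgeMeasure_edgePart_lt_top e t).ne)

/-- Weak convergence of the derivatives, tested against these indicators, becomes pointwise
convergence of the increments along edges. -/
lemma integral_mul_edgeIndicator {F : Edge d × ℝ → ℝ} (hF : MemLp F 2 (edgeMeasure d)) (e : Edge d)
    {t : ℝ} (ht : t ∈ Icc (0 : ℝ) 1) :
    ∫ p, F p * edgeIndicator e t p ∂edgeMeasure d = ∫ s in (0 : ℝ)..t, F (e, s) := by
  have h1 : (fun p => F p * edgeIndicator e t p) = indicator ({e} ×ˢ Icc 0 t) F := by
    funext p
    by_cases hp : p ∈ ({e} : Set (Edge d)) ×ˢ Icc 0 t <;> simp [edgeIndicator, hp]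
  have hi : IntegrableOn F ({e} ×ˢ Icc 0 t) (edgeMeasure d) := by
    have : IsFiniteMeasure ((edgeMeasure d).restrict (({e} : Set (Edge d)) ×ˢ Icc 0 t)) :=
      ⟨by rw [Measure.restrict_apply_univ]; exact edgeMeasure_edgePart_lt_top e t⟩
    exact (hF.restrict _).integrable one_le_two
  rw [h1, integral_indicator (measurableSet_edgePart e t), edgeMeasure,
    setIntegral_prod _ hi, integral_singleton, Measure.real, Measure.count_singleton,
    Measure.restrict_restrict measurableSet_Icc,
    inter_eq_left.2 (Icc_subset_Icc_right ht.2), intervalIntegral.integral_of_le ht.1,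
    integral_Icc_eq_integral_Ioc]
  simp

lemma MemH1Grid.eq_add_integral {u : grid d → ℝ} (hu : MemH1Grid u) (e : Edge d) {t : ℝ}
    (ht : t ∈ Icc (0 : ℝ) 1) :
    u (edgePoint e t) = u (edgePoint e 0) +
      ∫ p, edgeDeriv u p * edgeIndicator e t p ∂edgeMeasure d := by
  rw [integral_mul_edgeIndicator hu.memLp_deriv e ht]
  have := ac_sub_eq_integral (hu.absolutelyContinuous e) (s := 0) (by simp) ht
  simp only [edgeDeriv]
  linarith

lemma absolutelyContinuousOnInterval_congr {f g : ℝ → ℝ} {a b : ℝ}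
    (hf : AbsolutelyContinuousOnInterval f a b) (h : EqOn f g (uIcc a b)) :
    AbsolutelyContinuousOnInterval g a b := by
  rw [absolutelyContinuousOnInterval_iff] at hf ⊢
  intro ε hε
  obtain ⟨δ, hδ, H⟩ := hf ε hε
  refine ⟨δ, hδ, fun E hE hlt => ?_⟩
  have := H E hE hlt
  rwa [Finset.sum_congr rfl fun i hi => by
    rw [h (hE.1 i hi).1, h (hE.1 i hi).2]] at this

/-- A function given on the edges by its vertex values and the integral of a function in `L²`. -/
lemma memH1Grid_of_eq_integral {u : grid d → ℝ} {g : Edge d × ℝ → ℝ}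
    (hg : MemLp g 2 (edgeMeasure d))
    (h : ∀ (e : Edge d), ∀ t ∈ Icc (0 : ℝ) 1,
      u (edgePoint e t) = u (edgePoint e 0) + ∫ s in (0 : ℝ)..t, g (e, s))
    (hu : eLpNorm (onEdges u) 2 (edgeMeasure d) < ⊤) :
    MemH1Grid u ∧ edgeDeriv u =ᵐ[edgeMeasure d] g := by
  have hgi : ∀ e, IntervalIntegrable (fun s => g (e, s)) volume 0 1 := fun e => by
    rw [intervalIntegrable_iff_integrableOn_Icc_of_le zero_le_one]
    have : MemLp (fun s => g (e, s)) 2 unitMeasure :=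
      ⟨aestronglyMeasurable_edgeMeasure_iff.1 hg.1 e, (eLpNorm_edge_le g e).trans_lt hg.2⟩
    exact this.integrable one_le_two
  have hac : ∀ e, AbsolutelyContinuousOnInterval (fun t => u (edgePoint e t)) 0 1 := fun e => by
    have h1 := (hgi e).absolutelyContinuousOnInterval_intervalIntegral (c := 0) (by simp)
    have h2 : AbsolutelyContinuousOnInterval (fun _ : ℝ => u (edgePoint e 0)) 0 1 :=
      contDiff_const.contDiffOn.absolutelyContinuousOnInterval
    refine absolutelyContinuousOnInterval_congr (h2.add h1) fun t ht => ?_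
    rw [uIcc_of_le zero_le_one] at ht
    exact (h e t ht).symm
  have hder : edgeDeriv u =ᵐ[edgeMeasure d] g := by
    rw [EventuallyEq, ae_edgeMeasure_iff]
    intro e
    have h1 := (hgi e).ae_hasDerivAt_integral
    -- At an endpoint the two-sided derivative depends on values outside the edge, so only interior
    -- points are compared.
    rw [unitMeasure, ← restrict_Ioo_eq_restrict_Icc]
    refine (ae_restrict_iff' measurableSet_Ioo).2 ?_
    filter_upwards [h1] with t h1 ht
    have h2 := (h1 (by rw [uIcc_of_le zero_le_one]; exact Ioo_subset_Icc_self ht) 0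
      (by simp)).const_add (u (edgePoint e 0))
    have h3 : (fun t => u (edgePoint e t)) =ᶠ[𝓝 t]
        fun x => u (edgePoint e 0) + ∫ s in (0 : ℝ)..x, g (e, s) := by
      filter_upwards [Ioo_mem_nhds ht.1 ht.2] with x hx
      exact h e x (Ioo_subset_Icc_self hx)
    exact (h2.congr_of_eventuallyEq h3).deriv
  refine ⟨⟨hac, ⟨?_, hu⟩, (memLp_congr_ae hder).2 hg⟩, hder⟩
  rw [aestronglyMeasurable_edgeMeasure_iff]
  exact fun e => aestronglyMeasurable_of_ac (hac e)

/-- Bounded sequences of `H¹` of the grid have subsequences that converge pointwise, and with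
derivatives that converge weakly in `L²`. -/
theorem exists_limit (j : Fin d) {u : ℕ → grid d → ℝ} (hu : ∀ n, MemH1Grid (u n)) {A M : ℝ}
    (hA : ∀ n, normTwo (u n) ≤ A) (hM : ∀ n, normDeriv (u n) ≤ M) :
    ∃ (φ : ℕ → ℕ) (w : grid d → ℝ), StrictMono φ ∧ MemH1Grid w ∧
      (∀ x, Tendsto (fun n => u (φ n) x) atTop (𝓝 (w x))) ∧
      ∀ h : Edge d × ℝ → ℝ, MemLp h 2 (edgeMeasure d) →
        Tendsto (fun n => ∫ p, edgeDeriv (u (φ n)) p * h p ∂edgeMeasure d) atTop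
          (𝓝 (∫ p, edgeDeriv w p * h p ∂edgeMeasure d)) := by
  have : Fact ((2 : ℝ≥0∞) ≠ ⊤) := ⟨by simp⟩
  obtain ⟨φ₁, g, hφ₁, hg, hweak⟩ := exists_weak_limit (fun n => (hu n).memLp_deriv) hM
  have hA0 : 0 ≤ A := (normTwo_nonneg _).trans (hA 0)
  have hM0 : 0 ≤ M := (normDeriv_nonneg _).trans (hM 0)
  set B := Real.sqrt (A ^ 2 + 2 * (A * M))
  have hB : ∀ n x, |u n x| ≤ B := fun n x => by
    refine Real.abs_le_sqrt (((hu n).sq_le x).trans ?_)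
    have := normTwo_nonneg (u n)
    have := normDeriv_nonneg (u n)
    gcongr
    exacts [hA n, hA n, hM n]
  -- The vertices are countable and the values bounded by B, so one subsequence converges at all
  -- vertices.
  have hcomp : IsCompact (univ.pi fun _ : Fin d → ℤ => Icc (-B) B) :=
    isCompact_univ_pi fun _ => isCompact_Icc
  obtain ⟨U, -, φ₂, hφ₂, hU⟩ := hcomp.tendsto_subseq
    (x := fun n => vertexValue j (u (φ₁ n))) fun n k _ => abs_le.1 (hB _ _)
  have hmono : StrictMono (φ₁ ∘ φ₂) := hφ₁.comp hφ₂
  have hedge : ∀ (e : Edge d), ∀ t ∈ Icc (0 : ℝ) 1,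
      Tendsto (fun n => u (φ₁ (φ₂ n)) (edgePoint e t)) atTop
        (𝓝 (U e.1 + ∫ s in (0 : ℝ)..t, g (e, s))) := by
    rintro ⟨k, i⟩ t ht
    have h1 : Tendsto (fun n => u (φ₁ (φ₂ n)) (edgePoint (k, i) 0)) atTop (𝓝 (U k)) := by
      rw [edgePoint_zero k i j]
      exact (tendsto_pi_nhds.1 hU) k
    have h2 := (hweak _ (memLp_edgeIndicator (k, i) t)).comp hφ₂.tendsto_atTop
    rw [integral_mul_edgeIndicator hg _ ht] at h2
    refine (h1.add h2).congr fun n => ?_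
    exact ((hu _).eq_add_integral (k, i) ht).symm
  have hex : ∀ x, ∃ c, Tendsto (fun n => u (φ₁ (φ₂ n)) x) atTop (𝓝 c) := fun x => by
    obtain ⟨e, t, ht, rfl⟩ := exists_edgePoint x
    exact ⟨_, hedge e t ht⟩
  choose w hw using hex
  have hwe : ∀ (e : Edge d), ∀ t ∈ Icc (0 : ℝ) 1,
      w (edgePoint e t) = U e.1 + ∫ s in (0 : ℝ)..t, g (e, s) := fun e t ht =>
    tendsto_nhds_unique (hw _) (hedge e t ht)
  have hw0 : ∀ e : Edge d, w (edgePoint e 0) = U e.1 := fun e => by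
    rw [hwe e 0 (by simp)]; simp
  -- Fatou's lemma: pointwise limits of functions bounded in L² are in L².
  have hfin : eLpNorm (onEdges w) 2 (edgeMeasure d) < ⊤ := by
    have h1 := Lp.eLpNorm_lim_le_liminf_eLpNorm (p := 2) (μ := edgeMeasure d)
      (f := fun n => onEdges (u (φ₁ (φ₂ n)))) (fun n => (hu _).memLp.1) (onEdges w)
      (Eventually.of_forall fun p => hw _)
    refine h1.trans_lt (lt_of_le_of_lt ?_ (ENNReal.ofReal_lt_top (r := A)))
    refine (liminf_le_liminf (v := fun _ => ENNReal.ofReal A) (Eventually.of_forall fun n => ?_)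
      ?_ ?_).trans (by simp)
    · exact ENNReal.le_ofReal_iff_toReal_le (hu _).memLp.2.ne hA0 |>.2 (hA _)
    · isBoundedDefault
    · isBoundedDefault
  obtain ⟨hwm, hwd⟩ := memH1Grid_of_eq_integral (u := w) hg
    (fun e t ht => by rw [hwe e t ht, hw0]) hfin
  refine ⟨φ₁ ∘ φ₂, w, hmono, hwm, hw, fun h hh => ?_⟩
  have e : ∫ p, edgeDeriv w p * h p ∂edgeMeasure d = ∫ p, g p * h p ∂edgeMeasure d :=
    integral_congr_ae (hwd.mono fun p hp => by simp only [hp])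
  rw [e]
  exact (hweak h hh).comp hφ₂.tendsto_atTop

/-! ### Splitting of the norms along weakly convergent sequences -/

lemma rpow_toReal_eLpNorm {α : Type*} [MeasurableSpace α] {μ : Measure α} {f : α → ℝ} {q : ℝ}
    (hq : 0 < q) (hf : MemLp f (ENNReal.ofReal q) μ) :
    (eLpNorm f (ENNReal.ofReal q) μ).toReal ^ q = ∫ x, |f x| ^ q ∂μ := by
  have h0 : 0 ≤ ∫ x, |f x| ^ q ∂μ := integral_nonneg fun x => by positivity
  rw [hf.eLpNorm_eq_integral_rpow_norm (by simpa using hq) (by simp), ENNReal.toReal_ofReal hq.le]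
  simp only [Real.norm_eq_abs]
  rw [ENNReal.toReal_ofReal (by positivity), Real.rpow_inv_rpow h0 hq.ne']

lemma toReal_eLpNorm_two_sq {α : Type*} [MeasurableSpace α] {μ : Measure α} {f : α → ℝ}
    (hf : MemLp f 2 μ) : (eLpNorm f 2 μ).toReal ^ 2 = ∫ x, f x ^ 2 ∂μ := by
  have := rpow_toReal_eLpNorm (q := 2) two_pos (by simpa using hf)
  simpa using this

lemma normPow_two (u : grid d → ℝ) : normPow 2 u = normTwo u := by
  simp [normPow, normTwo]

lemma tendsto_normPow_sub (j : Fin d) {u : ℕ → grid d → ℝ} (hu : ∀ n, MemH1Grid (u n))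
    {w : grid d → ℝ} (hw : MemH1Grid w) {q : ℝ} (hq : 2 ≤ q) {B : ℝ}
    (hB : ∀ n, normPow q (u n) ^ q ≤ B)
    (hlim : ∀ x, Tendsto (fun n => u n x) atTop (𝓝 (w x))) :
    Tendsto (fun n => normPow q (u n) ^ q - normPow q (u n - w) ^ q) atTop
      (𝓝 (normPow q w ^ q)) := by
  have hq0 : 0 < q := by linarith
  have e : ∀ v : grid d → ℝ, MemH1Grid v →
      normPow q v ^ q = ∫ p, |onEdges v p| ^ q ∂edgeMeasure d := fun v hv =>
    rpow_toReal_eLpNorm hq0 (hv.memLp_rpow j hq)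
  have hi : ∀ v : grid d → ℝ, MemH1Grid v →
      Integrable (fun p => |onEdges v p| ^ q) (edgeMeasure d) := fun v hv => by
    have := (hv.memLp_rpow j hq).integrable_norm_rpow (by simpa using hq0) (by simp)
    simpa [ENNReal.toReal_ofReal hq0.le] using this
  rw [e w hw]
  simp_rw [fun n => e _ (hu n), fun n => e _ ((hu n).sub hw)] at hB ⊢
  exact tendsto_integral_rpow_sub (by linarith) (fun n => (hu n).memLp.1) hw.memLp.1
    (fun n => hi _ (hu n)) (hi _ hw) hB (Eventually.of_forall fun p => hlim _)

/-- Expanding the square gives 2⟨u n', w'⟩ - ‖w'‖₂², so weak convergence is enough and no pointwise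
convergence of derivatives is needed. -/
lemma tendsto_normDeriv_sub {u : ℕ → grid d → ℝ} (hu : ∀ n, MemH1Grid (u n))
    {w : grid d → ℝ} (hw : MemH1Grid w)
    (hlim : ∀ h : Edge d × ℝ → ℝ, MemLp h 2 (edgeMeasure d) →
        Tendsto (fun n => ∫ p, edgeDeriv (u n) p * h p ∂edgeMeasure d) atTop
          (𝓝 (∫ p, edgeDeriv w p * h p ∂edgeMeasure d))) :
    Tendsto (fun n => normDeriv (u n) ^ 2 - normDeriv (u n - w) ^ 2) atTop
      (𝓝 (normDeriv w ^ 2)) := by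
  have e : ∀ v : grid d → ℝ, MemH1Grid v →
      normDeriv v ^ 2 = ∫ p, edgeDeriv v p ^ 2 ∂edgeMeasure d := fun v hv =>
    toReal_eLpNorm_two_sq hv.memLp_deriv
  have hsq : ∀ v : grid d → ℝ, MemH1Grid v →
      Integrable (fun p => edgeDeriv v p ^ 2) (edgeMeasure d) := fun v hv =>
    hv.memLp_deriv.integrable_sq
  have key : ∀ n, normDeriv (u n) ^ 2 - normDeriv (u n - w) ^ 2 =
      2 * ∫ p, edgeDeriv (u n) p * edgeDeriv w p ∂edgeMeasure d - normDeriv w ^ 2 := fun n => by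
    have hm : Integrable (fun p => edgeDeriv (u n) p * edgeDeriv w p) (edgeMeasure d) :=
      (hu n).memLp_deriv.integrable_mul hw.memLp_deriv
    have hs : ∫ p, edgeDeriv (u n - w) p ^ 2 ∂edgeMeasure d = ∫ p, edgeDeriv (u n) p ^ 2
        - 2 * (edgeDeriv (u n) p * edgeDeriv w p) + edgeDeriv w p ^ 2 ∂edgeMeasure d := by
      refine integral_congr_ae (((hu n).edgeDeriv_sub hw).mono fun p hp => ?_)
      simp only [hp, Pi.sub_apply]
      ring
    have ha := integral_add ((hsq _ (hu n)).sub (hm.const_mul 2)) (hsq _ hw)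
    simp only [Pi.sub_apply] at ha
    rw [e _ (hu n), e _ hw, e _ ((hu n).sub hw), hs, ha,
      integral_sub (hsq _ (hu n)) (hm.const_mul 2), integral_const_mul]
    ring
  simp_rw [key]
  have h1 := ((hlim _ hw.memLp_deriv).const_mul 2).sub_const (normDeriv w ^ 2)
  have h2 : 2 * ∫ p, edgeDeriv w p * edgeDeriv w p ∂edgeMeasure d - normDeriv w ^ 2 =
      normDeriv w ^ 2 := by
    rw [e _ hw]
    simp_rw [← sq]
    ring
  rwa [h2] at h1

/-- Strict superadditivity, which excludes the splitting of maximizing sequences. -/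
lemma eq_one_of_one_le_add {X Y s t : ℝ} (hX0 : 0 < X) (hX1 : X ≤ 1) (hY0 : 0 ≤ Y) (hY1 : Y ≤ 1)
    (hs : 0 < s) (ht : 0 < t) (hst : 1 < s + t)
    (h : 1 ≤ X ^ s * Y ^ t + (1 - X) ^ s * (1 - Y) ^ t) : X = 1 := by
  by_contra hne
  have hX : X < 1 := lt_of_le_of_ne hX1 hne
  set σ := s + t
  have hσ : 0 < σ := by linarith
  have hw : s / σ + t / σ = 1 := by rw [← add_div]; exact div_self hσ.ne'
  have hsσ : 0 < s / σ := by positivity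
  have htσ : 0 < t / σ := by positivity
  -- By the weighted arithmetic–geometric inequality the two products are at most Z^σ and (1 - Z)^σ,
  -- for one Z strictly between 0 and 1; their sum is below 1 because σ > 1.
  have key : ∀ a b : ℝ, 0 ≤ a → 0 ≤ b → a ^ s * b ^ t ≤ (s / σ * a + t / σ * b) ^ σ := by
    intro a b ha hb
    have h1 := Real.geom_mean_le_arith_mean2_weighted hsσ.le htσ.le ha hb hw
    have h2 := Real.rpow_le_rpow (by positivity) h1 hσ.le
    rwa [Real.mul_rpow (by positivity) (by positivity), ← Real.rpow_mul ha, ← Real.rpow_mul hb,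
      div_mul_cancel₀ _ hσ.ne', div_mul_cancel₀ _ hσ.ne'] at h2
  have k1 := key X Y hX0.le hY0
  have k2 := key (1 - X) (1 - Y) (by linarith) (by linarith)
  set Z := s / σ * X + t / σ * Y
  have hZ : s / σ * (1 - X) + t / σ * (1 - Y) = 1 - Z := by
    simp only [Z]; linear_combination hw
  rw [hZ] at k2
  have hZ0 : 0 < Z := by positivity
  have hZ1 : 0 < 1 - Z := by
    rw [← hZ]
    have : 0 < s / σ * (1 - X) := mul_pos hsσ (by linarith)
    have : 0 ≤ t / σ * (1 - Y) := mul_nonneg htσ.le (by linarith)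
    linarith
  have l1 := Real.rpow_lt_self_of_lt_one hZ0 (by linarith) hst
  have l2 := Real.rpow_lt_self_of_lt_one hZ1 (by linarith) hst
  linarith

/-! ### Existence of maximizers -/

lemma normPow_rpow_le_mul {q : ℝ} (h : Admissible d q) {K : ℝ} (hK : 0 ≤ K)
    (hQ : ∀ u : grid d → ℝ, MemH1Grid u → u ≠ 0 → realQuotient q u ≤ K) {u : grid d → ℝ}
    (hu : MemH1Grid u) :
    normPow q u ^ q ≤ K * (normTwo u ^ expTwo d q * normDeriv u ^ expDeriv d q) := by
  by_cases h0 : u = 0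
  · have hz : normPow q u = 0 := by
      have : onEdges u = 0 := by rw [h0]; rfl
      rw [normPow, this]; simp
    rw [hz, Real.zero_rpow (by linarith [h.two_lt])]
    have := normTwo_nonneg u
    have := normDeriv_nonneg u
    positivity
  · have hN := hu.normTwo_pos h0
    have hD := hu.normDeriv_pos h0
    exact (div_le_iff₀ (by positivity)).1 (hQ u hu h0)

lemma sq_rpow_half_real {x : ℝ} (hx : 0 ≤ x) (a : ℝ) : (x ^ 2) ^ (a / 2) = x ^ a := by
  rw [← Real.rpow_natCast, ← Real.rpow_mul hx]
  congr 1; push_cast; ring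

/-- The weak limit of a normalized maximizing sequence is a maximizer if it does not vanish. -/
theorem realQuotient_limit_eq {q : ℝ} (h : Admissible d q) {K : ℝ} (hK : 0 < K)
    (hQ : ∀ u : grid d → ℝ, MemH1Grid u → u ≠ 0 → realQuotient q u ≤ K)
    {u : ℕ → grid d → ℝ} (hu : ∀ n, MemH1Grid (u n)) (hN : ∀ n, normTwo (u n) = 1) {Λ : ℝ}
    (hΛ : 0 < Λ) (hD : Tendsto (fun n => normDeriv (u n)) atTop (𝓝 Λ))
    (hlim : Tendsto (fun n => realQuotient q (u n)) atTop (𝓝 K))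
    {w : grid d → ℝ} (hw : MemH1Grid w) (hw0 : w ≠ 0)
    (hpt : ∀ x, Tendsto (fun n => u n x) atTop (𝓝 (w x)))
    (hweak : ∀ h : Edge d × ℝ → ℝ, MemLp h 2 (edgeMeasure d) →
        Tendsto (fun n => ∫ p, edgeDeriv (u n) p * h p ∂edgeMeasure d) atTop
          (𝓝 (∫ p, edgeDeriv w p * h p ∂edgeMeasure d))) :
    realQuotient q w = K := by
  have hq := h.two_lt
  have ha := h.expTwo_pos
  have hb := h.expDeriv_pos
  have hwN := hw.normTwo_pos hw0
  have hwD := hw.normDeriv_pos hw0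
  set a := expTwo d q with hadef
  set b := expDeriv d q with hbdef
  have hun0 : ∀ n, u n ≠ 0 := fun n h0 => by
    have h1 := hN n
    have : onEdges (u n) = 0 := by rw [h0]; rfl
    rw [normTwo, this] at h1
    simp at h1
  have hPn : ∀ n, normPow q (u n) ^ q = realQuotient q (u n) * normDeriv (u n) ^ b := fun n => by
    have := (hu n).normDeriv_pos (hun0 n)
    rw [realQuotient, hN n, Real.one_rpow, one_mul, div_mul_cancel₀ _ (by positivity)]
  have hPlim : Tendsto (fun n => normPow q (u n) ^ q) atTop (𝓝 (K * Λ ^ b)) := by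
    simp_rw [hPn]
    exact hlim.mul (hD.rpow_const (Or.inr hb.le))
  obtain ⟨B, hB⟩ := hPlim.bddAbove_range
  have hrP : Tendsto (fun n => normPow q (u n - w) ^ q) atTop
      (𝓝 (K * Λ ^ b - normPow q w ^ q)) := by
    have := hPlim.sub (tendsto_normPow_sub h.direction hu hw hq.le
      (fun n => hB (mem_range_self n)) hpt)
    simpa using this
  have hrN : Tendsto (fun n => normTwo (u n - w) ^ 2) atTop (𝓝 (1 - normTwo w ^ 2)) := by
    have h1 := tendsto_normPow_sub h.direction hu hw (q := 2) le_rfl (B := 1)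
      (fun n => by rw [normPow_two, hN n]; simp) hpt
    simp only [normPow_two, hN, Real.rpow_two, one_pow] at h1
    have := (tendsto_const_nhds (x := (1 : ℝ))).sub h1
    simpa using this
  have hrD : Tendsto (fun n => normDeriv (u n - w) ^ 2) atTop (𝓝 (Λ ^ 2 - normDeriv w ^ 2)) := by
    have := (hD.pow 2).sub (tendsto_normDeriv_sub hu hw hweak)
    simpa using this
  have hm1 : 0 ≤ 1 - normTwo w ^ 2 := ge_of_tendsto' hrN fun n => sq_nonneg _
  have hl1 : 0 ≤ Λ ^ 2 - normDeriv w ^ 2 := ge_of_tendsto' hrD fun n => sq_nonneg _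
  -- The Gagliardo–Nirenberg inequality for the remainder u n - w, in the limit.
  have hrem : K * Λ ^ b - normPow q w ^ q ≤
      K * ((1 - normTwo w ^ 2) ^ (a / 2) * (Λ ^ 2 - normDeriv w ^ 2) ^ (b / 2)) := by
    refine le_of_tendsto_of_tendsto' hrP (((hrN.rpow_const (Or.inr (by positivity))).mul
      (hrD.rpow_const (Or.inr (by positivity)))).const_mul K) fun n => ?_
    rw [sq_rpow_half_real (normTwo_nonneg _), sq_rpow_half_real (normDeriv_nonneg _)]
    exact normPow_rpow_le_mul h hK.le hQ ((hu n).sub hw)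
  have hwP : normPow q w ^ q ≤ K * (normTwo w ^ a * normDeriv w ^ b) :=
    normPow_rpow_le_mul h hK.le hQ hw
  have hDb : 0 < Λ ^ b := by positivity
  obtain ⟨Y, hY⟩ : ∃ Y, Y = normDeriv w ^ 2 / Λ ^ 2 := ⟨_, rfl⟩
  have hY0 : 0 ≤ Y := by rw [hY]; positivity
  have hY1 : Y ≤ 1 := by rw [hY, div_le_one (by positivity)]; linarith
  have hYe : normDeriv w ^ 2 = Y * Λ ^ 2 := by rw [hY]; field_simp
  have hYb : normDeriv w ^ b = Y ^ (b / 2) * Λ ^ b := by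
    rw [← sq_rpow_half_real hwD.le, hYe, Real.mul_rpow hY0 (by positivity),
      sq_rpow_half_real hΛ.le]
  have hYc : (Λ ^ 2 - normDeriv w ^ 2) ^ (b / 2) = (1 - Y) ^ (b / 2) * Λ ^ b := by
    rw [hYe, show Λ ^ 2 - Y * Λ ^ 2 = (1 - Y) * Λ ^ 2 by ring,
      Real.mul_rpow (by linarith) (by positivity), sq_rpow_half_real hΛ.le]
  -- Adding the inequalities for w and the remainder and dividing by KΛᵇ gives superadditivity data:
  -- X = ‖w‖₂², Y the share of w in the derivative energy, and exponents of sum q/2 > 1.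
  have hone : normTwo w ^ 2 = 1 := by
    refine eq_one_of_one_le_add (Y := Y) (s := a / 2) (t := b / 2) (by positivity) (by linarith)
      hY0 hY1 (by positivity) (by positivity) ?_ ?_
    · have := expTwo_add_expDeriv d q
      linarith
    · rw [sq_rpow_half_real hwN.le]
      rw [hYc] at hrem
      rw [hYb] at hwP
      have : K * Λ ^ b * 1 ≤ K * Λ ^ b * (normTwo w ^ a * Y ^ (b / 2) +
          (1 - normTwo w ^ 2) ^ (a / 2) * (1 - Y) ^ (b / 2)) := by
        linarith
      exact le_of_mul_le_mul_left this (by positivity)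
  have hone' : normTwo w = 1 := (pow_eq_one_iff_of_nonneg hwN.le two_ne_zero).1 hone
  refine le_antisymm (hQ w hw hw0) ?_
  -- With no L² mass left the remainder vanishes in Lᵠ, so ‖w‖_q^q ≥ KΛᵇ, while ‖w'‖₂ ≤ Λ.
  rw [hone, sub_self, Real.zero_rpow (by positivity), zero_mul, mul_zero] at hrem
  rw [realQuotient, hone', Real.one_rpow, one_mul, le_div_iff₀ (by positivity)]
  refine le_trans ?_ (sub_nonpos.1 hrem)
  gcongr
  exact abs_le_of_sq_le_sq' (by linarith) hΛ.le |>.2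

/-- A maximizing sequence with bounded derivatives, away from zero, yields a maximizer. -/
theorem exists_maximizer {q : ℝ} (h : Admissible d q) {K : ℝ} (hK : 0 < K)
    (hQ : ∀ u : grid d → ℝ, MemH1Grid u → u ≠ 0 → realQuotient q u ≤ K)
    {u : ℕ → grid d → ℝ} (hu : ∀ n, MemH1Grid (u n)) (hN : ∀ n, normTwo (u n) = 1) {δ M c : ℝ}
    (hδ : 0 < δ) (hD : ∀ n, normDeriv (u n) ∈ Icc δ M) (hc : 0 < c)
    (hcu : ∀ n, c ≤ realQuotient q (u n))
    (hlim : Tendsto (fun n => realQuotient q (u n)) atTop (𝓝 K)) :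
    ∃ w : grid d → ℝ, MemH1Grid w ∧ w ≠ 0 ∧ realQuotient q w = K := by
  have hq := h.two_lt
  have hb := h.expDeriv_pos
  have hM : 0 < M := hδ.trans_le ((hD 0).1.trans (hD 0).2)
  have hq2 : 0 < q - 2 := by linarith
  -- The Lᵠ norm satisfies ‖u n‖_q^q ≥ cδᵇ. If |u n| ≤ S everywhere, interpolation with ‖u n‖₂ = 1
  -- would give at most half of this.
  obtain ⟨S, hS⟩ : ∃ S, S = (c * δ ^ expDeriv d q / 2) ^ (1 / (q - 2)) := ⟨_, rfl⟩
  have hS0 : 0 < S := by rw [hS]; positivity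
  have hSq : S ^ (q - 2) = c * δ ^ expDeriv d q / 2 := by
    rw [hS, ← Real.rpow_mul (by positivity), one_div_mul_cancel hq2.ne', Real.rpow_one]
  have hbig : ∀ n, ∃ x, S < |u n x| := fun n => by
    by_contra! hcon
    have h1 := (hu n).normPow_rpow_le hq hS0.le hcon
    rw [hN n, one_pow, mul_one, hSq] at h1
    have h2 := hcu n
    have hDn : 0 < normDeriv (u n) := hδ.trans_le (hD n).1
    rw [realQuotient, hN n, Real.one_rpow, one_mul, le_div_iff₀ (by positivity)] at h2
    have h3 : c * δ ^ expDeriv d q ≤ c * normDeriv (u n) ^ expDeriv d q := by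
      gcongr; exact (hD n).1
    have : 0 < c * δ ^ expDeriv d q := by positivity
    linarith
  choose x hx using hbig
  choose e t ht hxe using fun n => exists_edgePoint (x n)
  -- Translate so that the point where |u n| > S lies on an edge based at the origin.
  set v : ℕ → grid d → ℝ := fun n => u n ∘ shift (e n).1
  have hv : ∀ n, MemH1Grid (v n) := fun n => (hu n).comp_shift _
  have hvx : ∀ n, S < |v n (edgePoint (0, (e n).2) (t n))| := fun n => by
    have e1 : shiftEdge (e n).1 (0, (e n).2) = e n := by simp [shiftEdge]
    simp only [v, Function.comp_apply, shift_edgePoint, e1, ← hxe]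
    exact hx n
  have hvN : ∀ n, normTwo (v n) = 1 := fun n => ((hu n).normTwo_shift _).trans (hN n)
  have hvD : ∀ n, normDeriv (v n) = normDeriv (u n) := fun n => (hu n).normDeriv_shift _
  have hvQ : ∀ n, realQuotient q (v n) = realQuotient q (u n) := fun n => by
    rw [realQuotient, (hu n).normPow_shift, (hu n).normTwo_shift, (hu n).normDeriv_shift,
      realQuotient]
  have hcomp : IsCompact ((univ : Set (Fin d)) ×ˢ (Icc (0 : ℝ) 1 ×ˢ Icc δ M)) :=
    isCompact_univ.prod (isCompact_Icc.prod isCompact_Icc)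
  obtain ⟨⟨i, s, Λ⟩, hmem, φ, hφ, hφlim⟩ := hcomp.tendsto_subseq
    (x := fun n => ((e n).2, t n, normDeriv (u n))) fun n => ⟨mem_univ _, ht n, hD n⟩
  rw [nhds_prod_eq, nhds_prod_eq, tendsto_prod_iff', tendsto_prod_iff'] at hφlim
  obtain ⟨hi, hs, hΛ⟩ := hφlim
  obtain ⟨-, hs01, hΛmem⟩ := hmem
  obtain ⟨ψ, w, hψ, hw, hpt, hweak⟩ := exists_limit i (fun n => hv (φ n)) (A := 1) (M := M)
    (fun n => (hvN _).le) fun n => by rw [hvD]; exact (hD _).2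
  have hw0 : w ≠ 0 := by
    intro hzero
    have h1 := (hpt (edgePoint (0, i) s)).abs
    rw [hzero, Pi.zero_apply, abs_zero] at h1
    have hi' : ∀ᶠ n in atTop, (e (φ (ψ n))).2 = i := by
      have := hi.eventually (show ({i} : Set (Fin d)) ∈ 𝓝 i by simp)
      exact hψ.tendsto_atTop.eventually this
    -- The bound on the derivatives makes the functions uniformly Hölder of exponent 1/2 on an edge;
    -- this carries the lower bound S from the moving points t n to their limit s.
    have hs' : Tendsto (fun n => |t (φ (ψ n)) - s| ^ (1 / 2 : ℝ) * M) atTop (𝓝 0) := by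
      have := (((hs.comp hψ.tendsto_atTop).sub_const s).abs.rpow_const (p := 1 / 2)
        (Or.inr (by norm_num))).mul_const M
      simpa using this
    have h2 := h1.add hs'
    rw [add_zero] at h2
    have h3 : S ≤ 0 := by
      refine ge_of_tendsto h2 ?_
      filter_upwards [hi'] with n hn
      have h4 := hvx (φ (ψ n))
      rw [hn] at h4
      have h5 := enorm_sub_le_of_ac ((hv (φ (ψ n))).absolutelyContinuous (0, i)) hs01
        (ht (φ (ψ n)))
      have h6 : eLpNorm (deriv fun t => v (φ (ψ n)) (edgePoint (0, i) t)) 2 unitMeasure ≤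
          ENNReal.ofReal M := by
        refine (eLpNorm_edge_le (edgeDeriv (v (φ (ψ n)))) (0, i)).trans ?_
        rw [ENNReal.le_ofReal_iff_toReal_le (hv _).memLp_deriv.2.ne hM.le]
        exact (hvD _).le.trans (hD _).2
      have h7 := h5.trans (mul_le_mul_right h6 _)
      rw [ENNReal.ofReal_rpow_of_nonneg (abs_nonneg _) (by norm_num),
        ← ENNReal.ofReal_mul (by positivity), ← ofReal_norm,
        ENNReal.ofReal_le_ofReal_iff (by positivity), Real.norm_eq_abs] at h7
      have h8 := abs_sub_abs_le_abs_sub (v (φ (ψ n)) (edgePoint (0, i) (t (φ (ψ n)))))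
        (v (φ (ψ n)) (edgePoint (0, i) s))
      linarith
    linarith
  refine ⟨w, hw, hw0, realQuotient_limit_eq h hK hQ (fun n => hv (φ (ψ n))) (fun n => hvN _)
    (hδ.trans_le hΛmem.1) ?_ ?_ hw hw0 hpt hweak⟩
  · simp_rw [hvD]
    exact hΛ.comp hψ.tendsto_atTop
  · simp_rw [hvQ]
    exact hlim.comp ((hφ.comp hψ).tendsto_atTop)

lemma MemH1Grid.gridQuotient_le_gridConstant {u : grid d → ℝ} (hu : MemH1Grid u) (h0 : u ≠ 0)
    (q : ℝ) : gridQuotient q u ≤ gridConstant d q :=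
  le_iSup_of_le u (le_iSup₂_of_le hu h0 le_rfl)

lemma MemH1Grid.gridQuotient_eq_gridConstant {q : ℝ} (h : Admissible d q) {w : grid d → ℝ}
    (hw : MemH1Grid w) (hw0 : w ≠ 0)
    (hQ : ∀ u : grid d → ℝ, MemH1Grid u → u ≠ 0 → realQuotient q u ≤ realQuotient q w) :
    gridQuotient q w = gridConstant d q := by
  refine le_antisymm (hw.gridQuotient_le_gridConstant hw0 q)
    (iSup_le fun u => iSup₂_le fun hu hu0 => ?_)
  rw [hu.gridQuotient_eq hu0 h, hw.gridQuotient_eq hw0 h]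
  exact ENNReal.ofReal_le_ofReal (hQ u hu hu0)

/-- If the quotient exceeds the rescaled constant of the Euclidean space, maximizers exist. -/
theorem exists_maximizer_of_lt {q : ℝ} (h : Admissible d q) (hK : euclideanConstant d q ≠ ⊤)
    {u₁ : grid d → ℝ} (hu₁ : MemH1Grid u₁) (h₁ : u₁ ≠ 0)
    (hlt : (d : ℝ) ^ (((d : ℝ) - 2) * (q - 2) / 4) * (euclideanConstant d q).toReal <
      realQuotient q u₁) :
    ∃ w : grid d → ℝ, MemH1Grid w ∧ w ≠ 0 ∧
      ∀ u : grid d → ℝ, MemH1Grid u → u ≠ 0 → realQuotient q u ≤ realQuotient q w := by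
  -- One level c serves both regimes: functions of small or large derivative have quotient at most
  -- c, and c lies strictly below the supremum.
  obtain ⟨c, hc, hc₁⟩ := exists_between hlt
  have hc0 : 0 < c := lt_of_le_of_lt (by positivity) hc
  obtain ⟨δ, hδ, hsmall⟩ := exists_realQuotient_le_of_small_normDeriv h hK hc
  obtain ⟨C, hC⟩ := exists_realQuotient_le_of_le_normDeriv h hδ
  obtain ⟨M, hM⟩ := exists_realQuotient_le_of_large_normDeriv h hc0
  set R : Set ℝ := {r | ∃ u : grid d → ℝ, MemH1Grid u ∧ u ≠ 0 ∧ realQuotient q u = r}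
  have hR : R.Nonempty := ⟨_, u₁, hu₁, h₁, rfl⟩
  have hbdd : BddAbove R := by
    refine ⟨max c C, ?_⟩
    rintro r ⟨u, hu, h0, rfl⟩
    rcases le_total (normDeriv u) (δ * normTwo u) with hle | hle
    · exact (hsmall u hu h0 hle).trans (le_max_left _ _)
    · exact (hC u hu h0 hle).trans (le_max_right _ _)
  have hQ : ∀ u : grid d → ℝ, MemH1Grid u → u ≠ 0 → realQuotient q u ≤ sSup R :=
    fun u hu h0 => le_csSup hbdd ⟨u, hu, h0, rfl⟩
  have hcK : c < sSup R := hc₁.trans_le (hQ u₁ hu₁ h₁)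
  obtain ⟨r, -, hr, hrR⟩ := exists_seq_tendsto_sSup hR hbdd
  -- Discarding the first n₀ terms puts every quotient above c.
  obtain ⟨n₀, hn₀⟩ := eventually_atTop.1 (hr.eventually (lt_mem_nhds hcK))
  choose u hu hu0 hur using fun n => hrR (n + n₀)
  have hcu : ∀ n, c < realQuotient q (u n) := fun n => by
    rw [hur]; exact hn₀ _ (Nat.le_add_left _ _)
  have hNu : ∀ n, 0 < normTwo (u n) := fun n => (hu n).normTwo_pos (hu0 n)
  set v : ℕ → grid d → ℝ := fun n => (normTwo (u n))⁻¹ • u n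
  have hv : ∀ n, MemH1Grid (v n) := fun n => (hu n).smul _
  have hvN : ∀ n, normTwo (v n) = 1 := fun n => by
    have := hNu n
    rw [normTwo_smul, abs_of_pos (by positivity), inv_mul_cancel₀ this.ne']
  have hv0 : ∀ n, v n ≠ 0 := fun n => smul_ne_zero (inv_ne_zero (hNu n).ne') (hu0 n)
  have hvQ : ∀ n, realQuotient q (v n) = realQuotient q (u n) := fun n =>
    realQuotient_smul q (inv_ne_zero (hNu n).ne') _
  have hvD : ∀ n, normDeriv (v n) ∈ Icc δ M := fun n => by
    have hcn := hcu n
    rw [← hvQ] at hcn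
    constructor
    · by_contra! hcon
      exact hcn.not_ge (hsmall _ (hv n) (hv0 n) (by rw [hvN, mul_one]; exact hcon.le))
    · by_contra! hcon
      exact hcn.not_ge (hM _ (hv n) (hv0 n) (by rw [hvN, mul_one]; exact hcon.le))
  obtain ⟨w, hw, hw0, hwK⟩ := exists_maximizer h (hc0.trans hcK) hQ hv hvN hδ hvD hc0
    (fun n => by rw [hvQ]; exact (hcu n).le) (by
      simp_rw [hvQ, hur]
      exact hr.comp (tendsto_add_atTop_nat n₀))
  exact ⟨w, hw, hw0, by rwa [hwK]⟩

end CubicGrid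

end

/-! ### From the non-strict threshold to the strict one -/

theorem proposition2p6 (d : ℕ) (hd : 2 ≤ d) (q : ℝ) (hq : q ∈ Set.Ioc (2 : ℝ) (2 + 4 / (d : ℝ)))
    (h : ∃ u : CubicGrid.grid d → ℝ, CubicGrid.MemH1Grid u ∧ u ≠ 0 ∧
      ENNReal.ofReal ((d : ℝ) ^ (((d : ℝ) - 2) * (q - 2) / 4)) * CubicGrid.euclideanConstant d q ≤
        CubicGrid.gridQuotient q u) :
    ∃ w : CubicGrid.grid d → ℝ, CubicGrid.MemH1Grid w ∧ w ≠ 0 ∧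
      CubicGrid.gridQuotient q w = CubicGrid.gridConstant d q := by
  obtain ⟨u₀, hu₀, h₀, hle⟩ := h
  have hadm : CubicGrid.Admissible d q := ⟨hd, hq.1, hq.2⟩
  have hd0 : (0 : ℝ) < d := by linarith [hadm.cast_two_le]
  have hpow : 0 < (d : ℝ) ^ (((d : ℝ) - 2) * (q - 2) / 4) := by positivity
  rw [hu₀.gridQuotient_eq h₀ hadm] at hle
  -- The Euclidean inequality need not be known: a nonzero u₀ has a finite quotient, so the assumed
  -- lower bound itself makes the constant finite.
  have hK : CubicGrid.euclideanConstant d q ≠ ⊤ := by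
    intro hK
    rw [hK, ENNReal.mul_top (by simpa using hpow), top_le_iff] at hle
    exact ENNReal.ofReal_ne_top hle
  have hle' := ENNReal.toReal_mono ENNReal.ofReal_ne_top hle
  rw [ENNReal.toReal_mul, ENNReal.toReal_ofReal hpow.le,
    ENNReal.toReal_ofReal (CubicGrid.realQuotient_nonneg q u₀)] at hle'
  -- If u₀ is not a maximizer, some u₁ has a larger quotient, hence one strictly above the
  -- threshold.
  by_cases hmax : ∀ u : CubicGrid.grid d → ℝ, CubicGrid.MemH1Grid u → u ≠ 0 →
      CubicGrid.realQuotient q u ≤ CubicGrid.realQuotient q u₀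
  · exact ⟨u₀, hu₀, h₀, hu₀.gridQuotient_eq_gridConstant hadm h₀ hmax⟩
  · push Not at hmax
    obtain ⟨u₁, hu₁, h₁, hlt⟩ := hmax
    obtain ⟨w, hw, hw0, hwmax⟩ :=
      CubicGrid.exists_maximizer_of_lt hadm hK hu₁ h₁ (hle'.trans_lt hlt)
    exact ⟨w, hw, hw0, hw.gridQuotient_eq_gridConstant hadm hw0 hwmax⟩
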